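/- Theorem (error of parsimonious CQ). Let $\mu>-1$. There is a constant $C>0$, depending only on $\mu$ if $\mu\ge 0$, and only on $\mu$ and on the parameter $\lambda$ below if $-1<\mu<0$, such that the following holds. Let $X,Y$ be complex Hilbert spaces, let $K(s):X\to Y$, $\operatorname{Re}s>0$, be an analytic family of bounded linear operators with $\|K(s)\|_{Y\leftarrow X}\le M_0|s|^{\mu}$ for $\operatorname{Re}s>0$, let $N\ge 1$, $L\ge N$, $p\ge 0$ be integers, $\tau>0$, $0<\varepsilon<1$, $\lambda=\varepsilon^{1/(2N)}$, $\zeta_L=e^{2\pi i/L}$, and let $\delta(\zeta)=1-\zeta$ (implicit Euler method). Define $\Phi_{-1}=0$, $\Phi_0=\sqrt{10|\log\varepsilon|/(6N)}$ and $$\Phi_{j+1}=\begin{cases}\Phi_j+\min\{\Phi_j,\,-\tfrac83\log\lambda-\tfrac83\log\cos(\tfrac78\Phi_j)\}&\text{if }\Phi_j<1,\\ \pi&\text{otherwise,}\end{cases}$$ assume $\Phi_0<\pi$ (e.g. $-\log\lambda\le 0.08$), and let $M=\min\{j:\Phi_j=\pi\}$. Let $\mathcal T$ be the mesh of $[0,2\pi]$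 with elements $I_j=[\Phi_{j-1},\Phi_j]$ and $I_{2M+1-j}=2\pi-I_j$, $j=0,\dots,M$. Let $I_p^{\mathcal T}$ be the identity on $I_0$ and $I_{2M+1}$ and, on every other element, interpolation by polynomials of degree at most $p$ in the $p+1$ Chebyshev points $\cos\frac{(2i+1)\pi}{2p+2}$, $i=0,\dots,p$, mapped affinely from $[-1,1]$ to the element (at a common end point of two elements the value from either element may be used). For $g^0,\dots,g^N\in X$, with $g^0=0$ in the case $L=N$, let $$(K(\partial_t^\tau)g)_n=\sum_{j=0}^n W_{n-j}(K)\,g^j,\qquad K\Bigl(\frac{\delta(\zeta)}{\tau}\Bigr)=\sum_{n\ge 0}W_n(K)\zeta^n,$$ $$(I_p^{\mathcal T}K(\partial_t^{\tau,\lambda})g)_n=\frac{\lambda^{-n}}{L}\sum_{l=0}^{L-1}\zeta_L^{ln}\,(I_p^{\mathcal T}f)\Bigl(\frac{2\pi l}{L}\Bigr)\Bigl[\sum_{j=0}^N\lambda^j\zeta_L^{-jl}g^j\Bigr],\qquad f(\varphi)=K\Bigl(\frac{\delta(\lambda e^{-i\varphi})}{\tau}\Bigr).$$ Then $$\sqrt{N^{-1}\sum_{n=0}^N\bigl\|(K(\partial_t^\tau)g)_n-(I_p^{\mathcal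 T}K(\partial_t^{\tau,\lambda})g)_n\bigr\|_Y^2}\;\le\; C\,M_0\,\tau^{-\mu}\Bigl(N\frac{\lambda^L}{1-\lambda^L}+\lambda^{-N}2^{-p}\Bigr)\sqrt{N^{-1}\sum_{n=0}^N\|g^n\|_X^2}.$$ In particular $C$ is independent of $N$, $L$, $p$, $\tau$, $K$, $M_0$, $X$, $Y$ and $g$. -/

import Mathlib

noncomputable section

namespace ParsimoniousCQ

/-- Generating function of the implicit Euler method. -/
def eulerGen (ζ : ℂ) : ℂ := 1 - ζ

/-- The convolution quadrature weight `W_n(K)`: the `n`-th Taylor coefficient at `0` of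
`ζ ↦ K(δ(ζ)/τ)`. -/
def cqWeight {E : Type*} [NormedAddCommGroup E] [NormedSpace ℂ E]
    (K : ℂ → E) (τ : ℝ) (n : ℕ) : E :=
  ((n.factorial : ℂ))⁻¹ • iteratedDeriv n (fun ζ : ℂ => K (eulerGen ζ / (τ : ℂ))) 0

/-- Exact convolution quadrature `(K(∂_t^τ) g)_n = ∑_{j=0}^n W_{n-j}(K) g^j`. -/
def cq {X Y : Type*} [NormedAddCommGroup X] [NormedSpace ℂ X]
    [NormedAddCommGroup Y] [NormedSpace ℂ Y]
    (K : ℂ → X →L[ℂ] Y) (τ : ℝ) (g : ℕ → X) (n : ℕ) : Y :=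
  ∑ j ∈ Finset.range (n + 1), cqWeight K τ (n - j) (g j)

/-- The breakpoints `Φ_0, Φ_1, …` given by the recursion for the implicit Euler method. -/
def meshPoint (N : ℕ) (ε lam : ℝ) : ℕ → ℝ
  | 0 => Real.sqrt (10 * |Real.log ε| / (6 * (N : ℝ)))
  | j + 1 =>
    if meshPoint N ε lam j < 1 then
      meshPoint N ε lam j + min (meshPoint N ε lam j)
        (-(8 / 3) * Real.log lam - 8 / 3 * Real.log (Real.cos (7 / 8 * meshPoint N ε lam j)))
    else Real.pi

/-- The terminal index `M`: the first `j` with `Φ_j = π`. -/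
def meshLast (N : ℕ) (ε lam : ℝ) : ℕ :=
  sInf {j : ℕ | meshPoint N ε lam j = Real.pi}

/-- `Φ_{k-1}`, with the convention `Φ_{-1} = 0`. -/
def meshPred (N : ℕ) (ε lam : ℝ) : ℕ → ℝ
  | 0 => 0
  | k + 1 => meshPoint N ε lam k

/-- Left end point of the element `I_k`, `0 ≤ k ≤ 2M+1`: `I_k = [Φ_{k-1}, Φ_k]` for `k ≤ M`, and
`I_k = 2π - I_{2M+1-k}` for `M+1 ≤ k ≤ 2M+1`. -/
def elemLeft (N : ℕ) (ε lam : ℝ) (k : ℕ) : ℝ :=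
  if k ≤ meshLast N ε lam then meshPred N ε lam k
  else 2 * Real.pi - meshPoint N ε lam (2 * meshLast N ε lam + 1 - k)

/-- Right end point of the element `I_k`, `0 ≤ k ≤ 2M+1`. -/
def elemRight (N : ℕ) (ε lam : ℝ) (k : ℕ) : ℝ :=
  if k ≤ meshLast N ε lam then meshPoint N ε lam k
  else 2 * Real.pi - meshPred N ε lam (2 * meshLast N ε lam + 1 - k)

/-- `e` selects for every `φ ∈ [0, 2π]` an element of the mesh that contains `φ`
(there is a choice only at common end points of two elements). -/
def IsElementChoice (N : ℕ) (ε lam : ℝ) (e : ℝ → ℕ) : Prop :=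
  ∀ φ ∈ Set.Icc 0 (2 * Real.pi), e φ ≤ 2 * meshLast N ε lam + 1 ∧
    φ ∈ Set.Icc (elemLeft N ε lam (e φ)) (elemRight N ε lam (e φ))

/-- The `p + 1` Chebyshev points, transported affinely from `[-1, 1]` to `[a, b]`. -/
def chebNode (p : ℕ) (a b : ℝ) (i : ℕ) : ℝ :=
  (a + b) / 2 + (b - a) / 2 *
    Real.cos ((2 * (i : ℝ) + 1) / (2 * (p : ℝ) + 2) * Real.pi)

/-- Value at `x` of the degree-`p` Chebyshev interpolant of `f` on `[a, b]` (Lagrange form). -/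
def chebInterp {E : Type*} [NormedAddCommGroup E] [NormedSpace ℂ E]
    (p : ℕ) (a b : ℝ) (f : ℝ → E) (x : ℝ) : E :=
  ∑ i ∈ Finset.range (p + 1),
    (((Lagrange.basis (Finset.range (p + 1)) (chebNode p a b) i).eval x : ℝ) : ℂ) •
      f (chebNode p a b i)

/-- The elementwise interpolant `(I_p^𝒯 f)(φ)`: the identity on the first and the last element,
degree-`p` Chebyshev interpolation on the other elements. -/
def meshInterp {E : Type*} [NormedAddCommGroup E] [NormedSpace ℂ E]
    (N : ℕ) (ε lam : ℝ) (e : ℝ → ℕ) (p : ℕ) (f : ℝ → E) (φ : ℝ) : E :=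
  if e φ = 0 ∨ e φ = 2 * meshLast N ε lam + 1 then f φ
  else chebInterp p (elemLeft N ε lam (e φ)) (elemRight N ε lam (e φ)) f φ

/-- The function `φ ↦ K(δ(λ e^{-iφ})/τ)` that is interpolated on `[0, 2π]`. -/
def contourFun {E : Type*} (K : ℂ → E) (τ lam : ℝ) (φ : ℝ) : E :=
  K (eulerGen ((lam : ℂ) * Complex.exp (-((φ : ℂ) * Complex.I))) / (τ : ℂ))

/-- `ζ_L = exp(2πi/L)`. -/
def rootL (L : ℕ) : ℂ := Complex.exp (2 * (Real.pi : ℂ) * Complex.I / (L : ℂ))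

/-- `ĝ^l = ∑_{j=0}^N λ^j ζ_L^{-jl} g^j`. -/
def scaledDFT {X : Type*} [NormedAddCommGroup X] [NormedSpace ℂ X]
    (N L : ℕ) (lam : ℝ) (g : ℕ → X) (l : ℕ) : X :=
  ∑ j ∈ Finset.range (N + 1), (((lam : ℂ) ^ j) * (rootL L ^ (j * l))⁻¹) • g j

/-- Parsimonious convolution quadrature `(I_p^𝒯 K(∂_t^{τ,λ}) g)_n`. The operator
`K(δ(λ ζ_L^{-l})/τ)` is the value of `contourFun K τ λ` at `φ = 2πl/L`. -/
def parsimoniousCQ {X Y : Type*} [NormedAddCommGroup X] [NormedSpace ℂ X]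
    [NormedAddCommGroup Y] [NormedSpace ℂ Y]
    (K : ℂ → X →L[ℂ] Y) (τ : ℝ) (N L p : ℕ) (ε lam : ℝ) (e : ℝ → ℕ)
    (g : ℕ → X) (n : ℕ) : Y :=
  (((lam : ℂ) ^ n)⁻¹ / (L : ℂ)) • ∑ l ∈ Finset.range L,
    (rootL L ^ (l * n)) •
      (meshInterp N ε lam e p (contourFun K τ lam) (2 * Real.pi * (l : ℝ) / (L : ℝ)))
        (scaledDFT N L lam g l)

/-- The discrete norm `(N⁻¹ ∑_{n=0}^N ‖x^n‖²)^{1/2}`. -/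
def ellNorm {Z : Type*} [NormedAddCommGroup Z] (N : ℕ) (x : ℕ → Z) : ℝ :=
  Real.sqrt ((N : ℝ)⁻¹ * ∑ n ∈ Finset.range (N + 1), ‖x n‖ ^ 2)

end ParsimoniousCQ

end

noncomputable section

namespace ParsimoniousCQ

/-! The error splits into two parts: trapezoidal quadrature with the exact contour function in place
of the weights, and replacing that function by its piecewise interpolant.

Quadrature. Cauchy's formula on `|ζ| = r < 1` bounds a weight by `M₀ τ^(-μ) r^(-m)` times the mean
of `|1 - ζ|^μ`. For `μ > -1` this mean is bounded uniformly in `r`, so `r → 1` gives a bound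
independent of `m` (`norm_cqWeight_le`). The trapezoidal rule with `L` nodes adds to the exact entry
only weights whose index is shifted by a positive multiple `kL`, damped by `λ^(kL)`; a geometric
series bounds each entry (`norm_trapezoid_sub_le`), and Cauchy-Schwarz over `N + 1` entries produces
the factor `N`.

Interpolation. By Parseval, operators acting in Fourier space with norm at most `δ` contribute at
most `2 δ λ^(-N)` (`sum_norm_sq_scaledMultiplier_le`), so a uniform bound on the interpolation error
is enough. The mesh recursion makes the image of each Bernstein ellipse with parameter `2` under `z
↦ 1 - λ e^(-iz)` stay in the right half-plane, bounded and away from `0`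
(`contourArg_mem_of_ellipse`). There the symbol is analytic and bounded, and Chebyshev interpolation
converges like `2^(-p)` (`chebInterp_error`). The distance to `0` depends on `λ` only, and matters
only when `μ < 0`. -/

lemma hasSum_of_eq {ι E : Type*} [AddCommMonoid E] [TopologicalSpace E] {f g : ι → E} {a b : E}
    (h : HasSum f a) (hf : ∀ i, f i = g i) (hab : a = b) : HasSum g b := by
  obtain rfl : f = g := funext hf
  exact hab ▸ h

/-! ### Chebyshev interpolation of functions analytic in a Bernstein ellipse -/

/-- The Joukowski map, which sends the annulus `1/ρ < |w| < ρ` onto a Bernstein ellipse. -/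
def joukowski (w : ℂ) : ℂ := (w + w⁻¹) / 2

/-- The angles whose cosines are the Chebyshev points. -/
def chebAngle (p i : ℕ) : ℝ := (2 * (i : ℝ) + 1) / (2 * (p : ℝ) + 2) * Real.pi

lemma chebNode_standard (p i : ℕ) : chebNode p (-1) 1 i = Real.cos (chebAngle p i) := by
  simp only [chebNode, chebAngle]; ring

lemma chebAngle_mem {p i : ℕ} (hi : i < p + 1) : chebAngle p i ∈ Set.Icc 0 Real.pi := by
  have h : (i : ℝ) + 1 ≤ p + 1 := by exact_mod_cast hi
  refine ⟨by unfold chebAngle; positivity, ?_⟩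
  refine mul_le_of_le_one_left Real.pi_pos.le ?_
  rw [div_le_one (by positivity)]
  linarith

lemma chebNode_injOn (p : ℕ) : Set.InjOn (chebNode p (-1) 1) (Finset.range (p + 1)) := by
  intro i hi j hj h
  rw [chebNode_standard, chebNode_standard] at h
  have h2 := Real.injOn_cos (chebAngle_mem (by simpa using hi)) (chebAngle_mem (by simpa using hj)) h
  unfold chebAngle at h2
  have h3 := mul_right_cancel₀ Real.pi_ne_zero h2
  rw [div_left_inj' (by positivity)] at h3
  exact_mod_cast (by linarith : (i : ℝ) = j)

/-- The Chebyshev interpolant of `cos θ ↦ cos (n θ)`. -/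
def chebInterpCos (p n : ℕ) (x : ℝ) : ℝ :=
  ∑ i ∈ Finset.range (p + 1),
    (Lagrange.basis (Finset.range (p + 1)) (chebNode p (-1) 1) i).eval x *
      Real.cos (n * chebAngle p i)

lemma chebInterpCos_of_le {p n : ℕ} (h : n ≤ p) (θ : ℝ) :
    chebInterpCos p n (Real.cos θ) = Real.cos (n * θ) := by
  have key := Lagrange.eq_interpolate_of_eval_eq (s := Finset.range (p + 1))
    (v := chebNode p (-1) 1) (f := Polynomial.Chebyshev.T ℝ n)
    (fun i => Real.cos (n * chebAngle p i)) (chebNode_injOn p)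
    (by rw [Polynomial.Chebyshev.degree_T]; simp only [Int.natAbs_natCast, Finset.card_range]; exact_mod_cast Nat.lt_succ_of_le h)
    (fun i _ => by rw [chebNode_standard, Polynomial.Chebyshev.T_real_cos]; simp)
  have h2 := congrArg (Polynomial.eval (Real.cos θ)) key
  rw [Polynomial.Chebyshev.T_real_cos, Lagrange.interpolate_apply, Polynomial.eval_finsetSum] at h2
  simp only [Polynomial.eval_mul, Polynomial.eval_C, Int.cast_natCast] at h2
  rw [h2, chebInterpCos]
  exact Finset.sum_congr rfl fun i _ => mul_comm _ _

lemma chebInterpCos_eq_neg {p n m : ℕ} (h : ∀ i : ℕ, Real.cos (n * chebAngle p i) =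
    -Real.cos (m * chebAngle p i)) (x : ℝ) : chebInterpCos p n x = -chebInterpCos p m x := by
  simp only [chebInterpCos, h, mul_neg, Finset.sum_neg_distrib]

lemma two_mul_chebAngle (p i : ℕ) :
    2 * ((p : ℝ) + 1) * chebAngle p i = i * (2 * Real.pi) + Real.pi := by
  unfold chebAngle
  have : 2 * (p : ℝ) + 2 ≠ 0 := by positivity
  field_simp

/-- At the nodes `2(p+1)θ_i` is an odd multiple of `π`, so there `cos (nθ)` agrees up to sign with a
mode of lower frequency: reflect `n` to `2(p+1) - n`, or subtract `2(p+1)`. The mode `n = p + 1`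
vanishes at all nodes. Descending to `n ≤ p`, where interpolation is exact, avoids any Lebesgue
constant growing with `p`. -/
lemma abs_chebInterpCos_le_one (p n : ℕ) (θ : ℝ) : |chebInterpCos p n (Real.cos θ)| ≤ 1 := by
  induction n using Nat.strong_induction_on with
  | _ n ih =>
    rcases Nat.lt_or_ge p n with h | h
    · rcases Nat.lt_or_ge n (2 * (p + 1)) with h2 | h2
      · rcases eq_or_ne n (p + 1) with rfl | h3
        · have : chebInterpCos p (p + 1) (Real.cos θ) = 0 := by
            refine Finset.sum_eq_zero fun i _ => ?_
            have h4 := two_mul_chebAngle p i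
            have : ((p + 1 : ℕ) : ℝ) * chebAngle p i = (i * Real.pi) + Real.pi / 2 := by
              push_cast; linarith
            rw [this, Real.cos_add_pi_div_two, Real.sin_nat_mul_pi]; simp
          rw [this]; simp
        · rw [chebInterpCos_eq_neg (m := 2 * (p + 1) - n), abs_neg]
          · exact ih _ (by omega)
          · intro i
            have h4 := two_mul_chebAngle p i
            have : (n : ℝ) * chebAngle p i = (i * (2 * Real.pi) + Real.pi) -
                ((2 * (p + 1) - n : ℕ) : ℝ) * chebAngle p i := by
              rw [Nat.cast_sub h2.le]; push_cast; linarith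
            rw [this, add_sub_assoc, add_comm, Real.cos_add_nat_mul_two_pi, Real.cos_pi_sub]
      · rw [chebInterpCos_eq_neg (m := n - 2 * (p + 1)), abs_neg]
        · exact ih _ (by omega)
        · intro i
          have h4 := two_mul_chebAngle p i
          have : (n : ℝ) * chebAngle p i = ((n - 2 * (p + 1) : ℕ) : ℝ) * chebAngle p i + Real.pi
              + i * (2 * Real.pi) := by
            rw [Nat.cast_sub h2]; push_cast; linarith
          rw [this, Real.cos_add_nat_mul_two_pi, Real.cos_add_pi]
    · rw [chebInterpCos_of_le h]; exact Real.abs_cos_le_one _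

lemma joukowski_exp (θ : ℝ) : joukowski (Complex.exp (θ * Complex.I)) = (Real.cos θ : ℝ) := by
  rw [joukowski, ← Complex.exp_neg, Complex.ofReal_cos, Complex.cos, neg_mul]

/-! ### Cosine series and interpolation error in the Bernstein ellipse -/

section Fourier

variable {f : ℂ → ℂ} {M : ℝ}

lemma circleIntegral_zpow_mul_joukowski
    (hd : ∀ w : ℂ, 1 / 2 < ‖w‖ → ‖w‖ < 2 → DifferentiableAt ℂ f (joukowski w))
    (n : ℤ) {r R : ℝ} (hr : 1 / 2 < r) (hrR : r ≤ R) (hR : R < 2) :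
    (∮ w in C(0, R), w ^ n * f (joukowski w)) = ∮ w in C(0, r), w ^ n * f (joukowski w) := by
  have hda : ∀ w : ℂ, 1 / 2 < ‖w‖ → ‖w‖ < 2 →
      DifferentiableAt ℂ (fun w => w ^ n * f (joukowski w)) w := by
    intro w h1 h2
    have hw : w ≠ 0 := by rintro rfl; simp at h1; linarith
    have hj : DifferentiableAt ℂ joukowski w :=
      (differentiableAt_id.add (differentiableAt_inv hw)).div_const 2
    exact (differentiableAt_zpow.2 (Or.inl hw)).mul ((hd w h1 h2).comp w hj)
  refine Complex.circleIntegral_eq_of_differentiable_on_annulus_off_countable (by linarith) hrR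
    Set.countable_empty ?_ ?_
  · intro w hw
    simp at hw
    exact (hda w (by linarith) (by linarith)).continuousAt.continuousWithinAt
  · intro w hw
    simp at hw
    exact hda w (by linarith) (by linarith)

/-- The contour may be moved to any circle inside the annulus of analyticity: outwards for `n ≥ 0`,
inwards for `n ≤ 0`. Since the annulus is open, the radii `2` and `1/2` are reached as limits of the
bounds. -/
lemma norm_circleIntegral_zpow_le
    (hd : ∀ w : ℂ, 1 / 2 < ‖w‖ → ‖w‖ < 2 → DifferentiableAt ℂ f (joukowski w))
    (hb : ∀ w : ℂ, 1 / 2 < ‖w‖ → ‖w‖ < 2 → ‖f (joukowski w)‖ ≤ M) (n : ℤ) :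
    ‖∮ w in C(0, 1), w ^ (-n - 1) * f (joukowski w)‖ ≤ 2 * Real.pi * (M * (1 / 2) ^ n.natAbs) := by
  have key : ∀ r : ℝ, 1 / 2 < r → r < 2 →
      ‖∮ w in C(0, 1), w ^ (-n - 1) * f (joukowski w)‖ ≤ 2 * Real.pi * (M * r ^ (-n)) := by
    intro r h1 h2
    have : (∮ w in C(0, 1), w ^ (-n - 1) * f (joukowski w)) =
        ∮ w in C(0, r), w ^ (-n - 1) * f (joukowski w) := by
      rcases le_total r 1 with h | h
      · exact circleIntegral_zpow_mul_joukowski hd _ h1 h (by norm_num)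
      · exact (circleIntegral_zpow_mul_joukowski hd _ (by norm_num) h h2).symm
    rw [this]
    have hr : 0 < r := by linarith
    refine (circleIntegral.norm_integral_le_of_norm_le_const (C := r ^ (-n - 1) * M) hr.le
      ?_).trans_eq ?_
    · intro z hz
      have hz' : ‖z‖ = r := by simpa using hz
      rw [norm_mul, norm_zpow, hz']
      exact mul_le_mul_of_nonneg_left (hb z (by linarith) (by linarith)) (by positivity)
    · rw [zpow_sub_one₀ hr.ne']; field_simp
  rcases le_total 0 n with h | h
  · have hlim : Filter.Tendsto (fun r : ℝ => 2 * Real.pi * (M * r ^ (-n))) (nhdsWithin 2 (Set.Iio 2))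
        (nhds (2 * Real.pi * (M * 2 ^ (-n)))) := by
      refine Filter.Tendsto.mono_left ?_ nhdsWithin_le_nhds
      exact ((continuousAt_zpow₀ (2 : ℝ) (-n) (Or.inl (by norm_num))).tendsto.const_mul M).const_mul _
    have := ge_of_tendsto hlim (by
      filter_upwards [Ioo_mem_nhdsLT (show (1 / 2 : ℝ) < 2 by norm_num)] with r hr
      exact key r hr.1 hr.2)
    obtain ⟨k, rfl⟩ := Int.eq_ofNat_of_zero_le h
    simpa using this
  · have hlim : Filter.Tendsto (fun r : ℝ => 2 * Real.pi * (M * r ^ (-n)))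
        (nhdsWithin (1 / 2) (Set.Ioi (1 / 2)))
        (nhds (2 * Real.pi * (M * (1 / 2) ^ (-n)))) := by
      refine Filter.Tendsto.mono_left ?_ nhdsWithin_le_nhds
      exact ((continuousAt_zpow₀ (1 / 2 : ℝ) (-n) (Or.inl (by norm_num))).tendsto.const_mul
        M).const_mul _
    have := ge_of_tendsto hlim (by
      filter_upwards [Ioo_mem_nhdsGT (show (1 / 2 : ℝ) < 2 by norm_num)] with r hr
      exact key r hr.1 hr.2)
    have hn : -n = (n.natAbs : ℤ) := by omega
    rwa [hn, zpow_natCast, ← hn] at this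

/-- Cosine expansion of a function that is bounded and analytic in the Bernstein ellipse with
parameter `2`. -/
lemma exists_hasSum_cos
    (hd : ∀ w : ℂ, 1 / 2 < ‖w‖ → ‖w‖ < 2 → DifferentiableAt ℂ f (joukowski w))
    (hb : ∀ w : ℂ, 1 / 2 < ‖w‖ → ‖w‖ < 2 → ‖f (joukowski w)‖ ≤ M) :
    ∃ a : ℤ → ℂ, (∀ n, ‖a n‖ ≤ M * (1 / 2) ^ n.natAbs) ∧
      ∀ θ : ℝ, HasSum (fun n : ℤ => a n * (Real.cos (n * θ) : ℝ)) (f (Real.cos θ : ℝ)) := by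
  have : Fact (0 < 2 * Real.pi) := ⟨Real.two_pi_pos⟩
  have hper : Function.Periodic (fun θ : ℝ => f (Real.cos θ : ℝ)) (2 * Real.pi) := by
    intro θ; simp only [Real.cos_add_two_pi]
  have hcont : Continuous (fun θ : ℝ => f (Real.cos θ : ℝ)) := by
    rw [continuous_iff_continuousAt]
    intro θ
    have h1 := hd (Complex.exp (θ * Complex.I)) (by rw [Complex.norm_exp_ofReal_mul_I]; norm_num)
      (by rw [Complex.norm_exp_ofReal_mul_I]; norm_num)
    rw [joukowski_exp] at h1
    exact ContinuousAt.comp (f := fun θ : ℝ => ((Real.cos θ : ℝ) : ℂ)) h1.continuousAt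
      (by fun_prop)
  let G : C(AddCircle (2 * Real.pi), ℂ) := ⟨hper.lift, continuous_coinduced_dom.mpr hcont⟩
  have hG : ∀ θ : ℝ, G (θ : AddCircle (2 * Real.pi)) = f (Real.cos θ : ℝ) := fun θ => rfl
  have hcoef : ∀ n : ℤ, ‖fourierCoeff G n‖ ≤ M * (1 / 2) ^ n.natAbs := by
    intro n
    -- Substitute `w = e^(iθ)`: the extra `w⁻¹` and the factor `-i` cancel `dw = i w dθ`.
    have h1 : fourierCoeff G n = (1 / (2 * Real.pi)) •
        (-Complex.I * ∮ w in C(0, 1), w ^ (-n - 1) * f (joukowski w)) := by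
      rw [fourierCoeff_eq_intervalIntegral G n 0, zero_add, circleIntegral,
        ← intervalIntegral.integral_const_mul]
      congr 1
      refine intervalIntegral.integral_congr fun θ _ => ?_
      simp only [hG]
      rw [fourier_coe_apply, deriv_circleMap, circleMap_zero, Complex.ofReal_one, one_mul,
        joukowski_exp, zpow_sub_one₀ (Complex.exp_ne_zero _), ← Complex.exp_int_mul]
      simp only [smul_eq_mul]
      have h3 : 2 * (Real.pi : ℂ) * Complex.I * ((-n : ℤ) : ℂ) * θ / ((2 * Real.pi : ℝ) : ℂ) =
          ((-n : ℤ) : ℂ) * (θ * Complex.I) := by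
        have : (Real.pi : ℂ) ≠ 0 := by exact_mod_cast Real.pi_ne_zero
        push_cast; field_simp
      rw [h3]
      have h4 := Complex.exp_ne_zero (θ * Complex.I)
      field_simp
      rw [Complex.I_sq]; ring
    rw [h1, norm_smul, norm_mul, norm_neg, Complex.norm_I, one_mul, Real.norm_of_nonneg (by positivity)]
    calc _ ≤ 1 / (2 * Real.pi) * (2 * Real.pi * (M * (1 / 2) ^ n.natAbs)) :=
          mul_le_mul_of_nonneg_left (norm_circleIntegral_zpow_le hd hb n) (by positivity)
      _ = _ := by field_simp
  have hsummable : Summable (fun n : ℤ => M * (1 / 2 : ℝ) ^ n.natAbs) := by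
    refine Summable.mul_left _ (Summable.of_nat_of_neg ?_ ?_) <;>
    · simpa using (summable_geometric_of_lt_one (r := (1/2 : ℝ)) (by norm_num) (by norm_num))
  have hs : Summable (fourierCoeff G) := Summable.of_norm_bounded hsummable hcoef
  refine ⟨fourierCoeff G, hcoef, fun θ => ?_⟩
  have h1 := has_pointwise_sum_fourier_series_of_summable hs (θ : AddCircle (2 * Real.pi))
  -- Averaging the series at `θ` and `-θ`, where the function takes the same value, turns
  -- exponentials into cosines.
  have h2 := has_pointwise_sum_fourier_series_of_summable hs ((-θ : ℝ) : AddCircle (2 * Real.pi))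
  have h3 := (h1.add h2).mul_left (1 / 2)
  rw [hG, hG, Real.cos_neg] at h3
  refine hasSum_of_eq h3 (fun n => ?_) ?_
  · rw [fourier_coe_apply, fourier_coe_apply, Complex.ofReal_cos, Complex.cos]
    have : (Real.pi : ℂ) ≠ 0 := by exact_mod_cast Real.pi_ne_zero
    have e1 : 2 * (Real.pi : ℂ) * Complex.I * n * θ / ((2 * Real.pi : ℝ) : ℂ) =
      ((n * θ : ℝ) : ℂ) * Complex.I := by push_cast; field_simp
    have e2 : 2 * (Real.pi : ℂ) * Complex.I * n * ((-θ : ℝ) : ℂ) / ((2 * Real.pi : ℝ) : ℂ) =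
      -((n * θ : ℝ) : ℂ) * Complex.I := by push_cast; field_simp
    rw [e1, e2]; simp only [smul_eq_mul]; ring
  · ring

/-- Interpolate the cosine series mode by mode. Modes with `|n| ≤ p` are reproduced; every other one
has error at most `2`. The two tails of `2 M 2^(-|n|)` sum to `2 M 2^(-p)` each. -/
lemma chebInterp_error_cos
    (hd : ∀ w : ℂ, 1 / 2 < ‖w‖ → ‖w‖ < 2 → DifferentiableAt ℂ f (joukowski w))
    (hb : ∀ w : ℂ, 1 / 2 < ‖w‖ → ‖w‖ < 2 → ‖f (joukowski w)‖ ≤ M) (p : ℕ) (θ : ℝ) :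
    ‖f (Real.cos θ : ℝ) - chebInterp p (-1) 1 (fun x : ℝ => f x) (Real.cos θ)‖ ≤
      4 * M * (1 / 2) ^ p := by
  obtain ⟨a, ha, hsum⟩ := exists_hasSum_cos hd hb
  have h1 : HasSum (fun n : ℤ => a n * ((Real.cos (n * θ) -
      chebInterpCos p n.natAbs (Real.cos θ) : ℝ) : ℂ))
      (f (Real.cos θ : ℝ) - chebInterp p (-1) 1 (fun x : ℝ => f x) (Real.cos θ)) := by
    have h2 : HasSum (fun n : ℤ => ∑ i ∈ Finset.range (p + 1),
        (((Lagrange.basis (Finset.range (p + 1)) (chebNode p (-1) 1) i).eval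
          (Real.cos θ) : ℝ) : ℂ) * (a n * (Real.cos (n * chebAngle p i) : ℝ)))
        (chebInterp p (-1) 1 (fun x : ℝ => f x) (Real.cos θ)) := by
      refine hasSum_sum fun i _ => ?_
      simp only [smul_eq_mul, chebNode_standard]
      exact (hsum _).mul_left _
    refine hasSum_of_eq ((hsum θ).sub h2) (fun n => ?_) rfl
    have : (∑ i ∈ Finset.range (p + 1),
        (((Lagrange.basis (Finset.range (p + 1)) (chebNode p (-1) 1) i).eval
          (Real.cos θ) : ℝ) : ℂ) * (a n * (Real.cos (n * chebAngle p i) : ℝ))) =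
        a n * (chebInterpCos p n.natAbs (Real.cos θ) : ℝ) := by
      rw [chebInterpCos]
      push_cast
      rw [Finset.mul_sum]
      refine Finset.sum_congr rfl fun i _ => ?_
      have hc : Complex.cos ((n : ℂ) * chebAngle p i) =
          Complex.cos ((n.natAbs : ℂ) * chebAngle p i) := by
        rcases Int.natAbs_eq n with h | h
        · conv_lhs => rw [h]
          simp
        · conv_lhs => rw [h]
          simp
      rw [hc]; ring
    rw [this]; push_cast; ring
  have hM : 0 ≤ M := (norm_nonneg _).trans (hb 1 (by norm_num) (by norm_num))
  have hbd : ∀ n : ℤ, ‖a n * ((Real.cos (n * θ) -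
      chebInterpCos p n.natAbs (Real.cos θ) : ℝ) : ℂ)‖ ≤
      if p < n.natAbs then 2 * M * (1 / 2) ^ n.natAbs else 0 := by
    intro n
    have hc : Real.cos (n * θ) = Real.cos (n.natAbs * θ) := by
      rcases Int.natAbs_eq n with h | h
      · conv_lhs => rw [h]
        simp
      · conv_lhs => rw [h]
        simp
    split_ifs with h
    · rw [norm_mul, Complex.norm_real, Real.norm_eq_abs]
      have h3 : |Real.cos (n * θ) - chebInterpCos p n.natAbs (Real.cos θ)| ≤ 2 :=
        (abs_sub _ _).trans (by
          linarith [Real.abs_cos_le_one (n * θ), abs_chebInterpCos_le_one p n.natAbs θ])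
      calc _ ≤ (M * (1 / 2) ^ n.natAbs) * 2 := mul_le_mul (ha n) h3 (abs_nonneg _) (by positivity)
        _ = _ := by ring
    · rw [chebInterpCos_of_le (not_lt.1 h), hc]; simp
  have htail : HasSum (fun n : ℕ => if p < n + 1 then 2 * M * (1 / 2 : ℝ) ^ (n + 1) else 0)
      (2 * M * (1 / 2) ^ p) := by
    have h0 : HasSum (fun k : ℕ => 2 * M * (1 / 2 : ℝ) ^ (k + p + 1)) (2 * M * (1 / 2) ^ p) := by
      refine hasSum_of_eq ((hasSum_geometric_two).mul_left (2 * M * (1 / 2 : ℝ) ^ (p + 1)))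
        (fun k => ?_) ?_ <;> ring
    rw [← hasSum_nat_add_iff' p]
    refine hasSum_of_eq h0 (fun k => ?_) ?_
    · rw [if_pos (by omega)]
    · symm
      rw [Finset.sum_eq_zero, sub_zero]
      intro i hi
      rw [if_neg (by simp at hi; omega)]
  have hg : HasSum (fun n : ℤ => if p < n.natAbs then 2 * M * (1 / 2 : ℝ) ^ n.natAbs else 0)
      (4 * M * (1 / 2) ^ p) := by
    have := HasSum.of_nat_of_neg_add_one
      (f := fun n : ℤ => if p < n.natAbs then 2 * M * (1 / 2 : ℝ) ^ n.natAbs else 0)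
      (m := 2 * M * (1 / 2) ^ p) (m' := 2 * M * (1 / 2) ^ p) ?_ ?_
    · exact hasSum_of_eq this (fun _ => rfl) (by ring)
    · rw [← hasSum_nat_add_iff' 1]
      refine hasSum_of_eq htail (fun n => ?_) (by simp)
      rw [show ((n + 1 : ℕ) : ℤ).natAbs = n + 1 by omega]
    · refine hasSum_of_eq htail (fun n => ?_) rfl
      have : (-((n : ℤ) + 1)).natAbs = n + 1 := by omega
      rw [this]
  rw [← h1.tsum_eq]
  exact tsum_of_norm_bounded hg hbd

end Fourier

lemma lagrange_basis_affine (s : Finset ℕ) (v : ℕ → ℝ) (c h x : ℝ) (hh : h ≠ 0) (i : ℕ) :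
    (Lagrange.basis s (fun j => c + h * v j) i).eval (c + h * x) = (Lagrange.basis s v i).eval x := by
  simp only [Lagrange.basis, Polynomial.eval_prod, Lagrange.basisDivisor, Polynomial.eval_mul,
    Polynomial.eval_C, Polynomial.eval_sub, Polynomial.eval_X]
  refine Finset.prod_congr rfl fun j _ => ?_
  rw [show c + h * v i - (c + h * v j) = h * (v i - v j) by ring,
    show c + h * x - (c + h * v j) = h * (x - v j) by ring, mul_inv]
  field_simp

lemma chebInterp_affine {E : Type*} [NormedAddCommGroup E] [NormedSpace ℂ E] (p : ℕ) {a b : ℝ}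
    (hab : a < b) (f : ℝ → E) (x : ℝ) :
    chebInterp p a b f ((a + b) / 2 + (b - a) / 2 * x) =
      chebInterp p (-1) 1 (fun y => f ((a + b) / 2 + (b - a) / 2 * y)) x := by
  have hn : chebNode p a b = fun i => (a + b) / 2 + (b - a) / 2 * chebNode p (-1) 1 i := by
    funext i; rw [chebNode_standard]; rfl
  unfold chebInterp
  refine Finset.sum_congr rfl fun i _ => ?_
  have hpos : 0 < (b - a) / 2 := by linarith
  rw [hn, lagrange_basis_affine _ _ _ _ _ hpos.ne']

/-- Chebyshev interpolation on `[a, b]` of a function that is analytic and bounded by `M` in the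
Bernstein ellipse of `[a, b]` with parameter `2`. -/
theorem chebInterp_error {E : Type*} [NormedAddCommGroup E] [NormedSpace ℂ E] {F : ℂ → E} {M a b : ℝ}
    (hab : a < b)
    (hd : ∀ w : ℂ, 1 / 2 < ‖w‖ → ‖w‖ < 2 →
      DifferentiableAt ℂ F (((a + b) / 2 : ℝ) + ((b - a) / 2 : ℝ) * joukowski w))
    (hb : ∀ w : ℂ, 1 / 2 < ‖w‖ → ‖w‖ < 2 →
      ‖F (((a + b) / 2 : ℝ) + ((b - a) / 2 : ℝ) * joukowski w)‖ ≤ M)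
    (p : ℕ) {x : ℝ} (hx : x ∈ Set.Icc a b) :
    ‖F x - chebInterp p a b (fun y : ℝ => F y) x‖ ≤ 4 * M * (1 / 2) ^ p := by
  have hM : 0 ≤ M := (norm_nonneg _).trans (hb 1 (by norm_num) (by norm_num))
  obtain ⟨θ, hθ⟩ : ∃ θ : ℝ, x = (a + b) / 2 + (b - a) / 2 * Real.cos θ := by
    have hpos : 0 < b - a := by linarith
    refine ⟨Real.arccos ((2 * x - a - b) / (b - a)), ?_⟩
    rw [Real.cos_arccos]
    · field_simp; ring
    · rw [le_div_iff₀ hpos]; linarith [hx.1]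
    · rw [div_le_iff₀ hpos]; linarith [hx.2]
  -- Testing with continuous functionals reduces vector values to the scalar case; the interpolation
  -- nodes and basis do not depend on the values.
  refine NormedSpace.norm_le_dual_bound ℂ _ (by positivity) fun ℓ => ?_
  have key := chebInterp_error_cos (M := M * ‖ℓ‖)
    (f := fun z => ℓ (F (((a + b) / 2 : ℝ) + ((b - a) / 2 : ℝ) * z))) ?_ ?_ p θ
  · rw [map_sub, hθ, chebInterp_affine p hab]
    have e : ℓ (chebInterp p (-1) 1 (fun y : ℝ =>
        F (((a + b) / 2 + (b - a) / 2 * y : ℝ) : ℂ)) (Real.cos θ)) =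
        chebInterp p (-1) 1 (fun y : ℝ => ℓ (F (((a + b) / 2 : ℝ) + ((b - a) / 2 : ℝ) * y)))
        (Real.cos θ) := by
      simp only [chebInterp, map_sum, map_smul]
      refine Finset.sum_congr rfl fun i _ => ?_
      push_cast; rfl
    rw [e]
    convert key using 1
    · push_cast; rfl
    · ring
  · intro w h1 h2
    refine ℓ.differentiableAt.comp _ ?_
    exact (hd w h1 h2).comp (joukowski w) (f := fun z : ℂ => (((a + b) / 2 : ℝ) : ℂ) + ((b - a) / 2 : ℝ) * z)
      (by fun_prop)
  · intro w h1 h2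
    rw [mul_comm M]
    exact (ℓ.le_opNorm _).trans (mul_le_mul_of_nonneg_left (hb w h1 h2) (norm_nonneg _))

/-! ### The contour function on the Bernstein ellipses of the mesh -/

/-- With `r = |w|` the image point lies on the ellipse with semi-axes `(r ± r⁻¹)/2`; `5/4` and `3/4`
are their values at `r = 2`. The signed semi-axis `B` is negative for `r < 1`. -/
lemma joukowski_coordinates {w : ℂ} (h1 : 1 / 2 < ‖w‖) (h2 : ‖w‖ < 2) :
    ∃ A B c s : ℝ, (joukowski w).re = A * c ∧ (joukowski w).im = B * s ∧ c ^ 2 + s ^ 2 = 1 ∧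
      1 ≤ A ∧ A < 5 / 4 ∧ |B| < 3 / 4 := by
  have hr : 0 < ‖w‖ := by linarith
  have hsq : ‖w‖ ^ 2 = w.re ^ 2 + w.im ^ 2 := by
    rw [← Complex.normSq_eq_norm_sq, Complex.normSq_apply]; ring
  have hinv : joukowski w = (w + w⁻¹) * ((1 / 2 : ℝ) : ℂ) := by
    rw [joukowski]; push_cast; ring
  refine ⟨(‖w‖ + ‖w‖⁻¹) / 2, (‖w‖ - ‖w‖⁻¹) / 2, w.re / ‖w‖, w.im / ‖w‖, ?_, ?_, ?_, ?_, ?_, ?_⟩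
  · rw [hinv, Complex.re_mul_ofReal, Complex.add_re, Complex.inv_re, Complex.normSq_eq_norm_sq]
    field_simp
  · rw [hinv, Complex.im_mul_ofReal, Complex.add_im, Complex.inv_im, Complex.normSq_eq_norm_sq]
    field_simp
    ring
  · rw [div_pow, div_pow, ← add_div, ← hsq, div_self (by positivity)]
  · rw [le_div_iff₀ two_pos, ← sub_nonneg]
    have : ‖w‖ + ‖w‖⁻¹ - 1 * 2 = (‖w‖ - 1) ^ 2 / ‖w‖ := by field_simp; ring
    rw [this]; positivity
  · rw [div_lt_iff₀ two_pos, ← sub_pos]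
    have : 5 / 4 * 2 - (‖w‖ + ‖w‖⁻¹) = (2 - ‖w‖) * (‖w‖ - 1 / 2) / ‖w‖ := by field_simp; ring
    rw [this]
    exact div_pos (mul_pos (by linarith) (by linarith)) hr
  · have h3 : ‖w‖⁻¹ < 2 := by
      rw [inv_lt_comm₀ hr two_pos]; linarith
    have h4 : 1 / 2 < ‖w‖⁻¹ := by
      rw [lt_inv_comm₀ (by norm_num) hr]; linarith
    rw [abs_lt]; constructor <;> linarith

lemma abs_mul_le_of_ellipse {A B c s : ℝ} (hcs : c ^ 2 + s ^ 2 = 1) (hA0 : 1 ≤ A) (hA : A < 5 / 4)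
    (hB : |B| < 3 / 4) : |A * c| ≤ 5 / 4 ∧ |B * s| < 3 / 4 := by
  have hc1 : |c| ≤ 1 := by
    rw [← sq_le_one_iff_abs_le_one]; linarith [sq_nonneg s]
  have hs1 : |s| ≤ 1 := by
    rw [← sq_le_one_iff_abs_le_one]; linarith [sq_nonneg c]
  rw [abs_mul, abs_mul, abs_of_nonneg (by linarith : 0 ≤ A)]
  exact ⟨(mul_le_of_le_one_right (by linarith) hc1).trans hA.le,
    (mul_le_of_le_one_right (abs_nonneg _) hs1).trans_lt hB⟩

/-- Concavity of the sine puts its graph below the tangent at `π/4`. This linearizes one side of the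
inequality for the last element. -/
lemma sin_le_tangent_pi_div_four {w : ℝ} (h0 : 0 ≤ w) (h1 : w ≤ Real.pi / 2) :
    Real.sin w ≤ Real.sqrt 2 / 2 * (1 + (w - Real.pi / 4)) := by
  have hpi := Real.pi_lt_d2
  set d := w - Real.pi / 4 with hd
  have hw : w = Real.pi / 4 + d := by rw [hd]; ring
  rw [hw, Real.sin_add, Real.sin_pi_div_four, Real.cos_pi_div_four]
  have key : Real.cos d + Real.sin d ≤ 1 + d := by
    rcases le_total 0 d with h | h
    · linarith [Real.cos_le_one d, Real.sin_le h]
    · have hb := Real.cos_bound (x := d) (by rw [abs_le]; constructor <;> linarith)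
      have hc := (abs_le.1 hb).2
      rw [abs_of_nonpos h] at hc
      rcases eq_or_lt_of_le h with h' | h'
      · simp [h']
      · have hs := Real.sin_gt_sub_cube (x := -d) (by linarith)
        rw [Real.sin_neg] at hs
        have hd1 : -1 ≤ d := by linarith
        nlinarith [mul_nonneg (sq_nonneg d) (by linarith : 0 ≤ 1 + d),
          mul_nonneg (mul_nonneg (sq_nonneg d) (by linarith : 0 ≤ 1 + d)) (by linarith : 0 ≤ -d)]
  have := mul_le_mul_of_nonneg_left key (by positivity : 0 ≤ Real.sqrt 2 / 2)
  linarith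

/-- The Bernstein ellipse of `[π - h, π]` stays in the region where `e^{|y|} cos x < 1`. -/
lemma exp_mul_cos_lt_one_of_last {h A B c s : ℝ} (h0 : 0 < h) (hh : h ≤ Real.pi - 1)
    (hcs : c ^ 2 + s ^ 2 = 1) (hA0 : 1 ≤ A) (hA : A < 5 / 4) (hB : |B| < 3 / 4) :
    Real.exp |h / 2 * (B * s)| * Real.cos (Real.pi - h / 2 + h / 2 * (A * c)) < 1 := by
  have hpi := Real.pi_lt_d2
  have hpi' := Real.pi_gt_d2
  set u := h / 2 - h / 2 * (A * c) with hu
  have hx : Real.pi - h / 2 + h / 2 * (A * c) = Real.pi - u := by rw [hu]; ring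
  rw [hx, Real.cos_pi_sub]
  rcases le_or_gt (Real.cos u * (-1)) 0 with hneg | hposc
  · have := mul_nonpos_of_nonneg_of_nonpos (Real.exp_pos |h / 2 * (B * s)|).le hneg
    linarith
  have hcosu : Real.cos u < 0 := by linarith
  obtain ⟨hAc', hAc⟩ := abs_le.1 (abs_mul_le_of_ellipse hcs hA0 hA hB).1
  have hm1 : h * -(5 / 4) ≤ h * (A * c) := mul_le_mul_of_nonneg_left hAc' h0.le
  have hm2 : h * (A * c) ≤ h * (5 / 4) := mul_le_mul_of_nonneg_left hAc h0.le
  have hu1 : -(Real.pi / 2) ≤ u := by linarith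
  have hu2 : Real.pi / 2 < u := by
    by_contra hcon
    exact absurd (Real.cos_nonneg_of_mem_Icc ⟨hu1, not_lt.1 hcon⟩) (by linarith)
  have hc : c < 0 := by
    by_contra hcon
    have h5 : 0 ≤ A * c := mul_nonneg (by linarith) (not_lt.1 hcon)
    have h6 : 0 ≤ h / 2 * (A * c) := by positivity
    linarith
  have hle : u ≤ (Real.pi - 1) / 2 * (1 + 5 / 4 * -c) := by
    have h7 : u = h / 2 * (1 - A * c) := by rw [hu]; ring
    rw [h7]
    have h8 : A * -c ≤ 5 / 4 * -c := mul_le_mul_of_nonneg_right hA.le (by linarith)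
    have h9 : 0 ≤ A * -c := mul_nonneg (by linarith) (by linarith)
    apply mul_le_mul <;> linarith
  -- A line above the unit circle: `|s| + 1.75 |c| ≤ √(1 + 1.75²) < 2.016`.
  have hs0 : |s| ≤ 2.016 - 1.75 * -c := by
    have h8 : (|s| + 1.75 * -c) ^ 2 ≤ 2.016 ^ 2 := by
      nlinarith [sq_nonneg (1.75 * |s| - -c), sq_abs s]
    have := abs_le_of_sq_le_sq h8 (by norm_num)
    linarith [(abs_le.1 this).2]
  have hy : |h / 2 * (B * s)| ≤ (Real.pi - 1) / 2 * (3 / 4 * |s|) := by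
    rw [abs_mul, abs_mul, abs_of_pos (by linarith : 0 < h / 2)]
    apply mul_le_mul
    · linarith
    · exact mul_le_mul_of_nonneg_right hB.le (abs_nonneg _)
    · positivity
    · linarith
  set y := |h / 2 * (B * s)| with hydef
  have hsin : -Real.cos u ≤ Real.sqrt 2 / 2 * (1 + (u - Real.pi / 2 - Real.pi / 4)) := by
    rw [← Real.sin_sub_pi_div_two]
    exact sin_le_tangent_pi_div_four (by linarith) (by linarith)
  -- The tangent of `e^(-y)` at `y = 0.4`, with `e^(-0.4)` rounded down to `0.67`.
  have hexp : 0.67 * (1.4 - y) ≤ Real.exp (-y) := by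
    rcases le_or_gt y 1.4 with h9 | h9
    · have e1 : Real.exp (-y) = Real.exp (-0.4) * Real.exp (0.4 - y) := by
        rw [← Real.exp_add]; congr 1; ring
      have e2 : (0.67 : ℝ) ≤ Real.exp (-0.4) := by
        have : Real.exp 0.4 ≤ 1 / 0.67 := by
          have := Real.exp_bound' (x := 0.4) (by norm_num) (by norm_num) (n := 5) (by norm_num)
          refine this.trans ?_
          norm_num [Finset.sum_range_succ, Nat.factorial]
        rw [Real.exp_neg]
        rw [le_inv_comm₀ (by norm_num) (Real.exp_pos _)]
        simpa using this
      have e3 : 1.4 - y ≤ Real.exp (0.4 - y) := by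
        have := Real.add_one_le_exp (0.4 - y)
        linarith
      rw [e1]
      exact mul_le_mul e2 e3 (by linarith) (Real.exp_pos _).le
    · have := Real.exp_pos (-y)
      linarith
  have hsqrt : Real.sqrt 2 ≤ 1.415 := by
    rw [Real.sqrt_le_left (by norm_num)]; norm_num
  -- After these linearizations both sides are affine in `-c`, with coefficients depending on `π`;
  -- decimal bounds for `π` decide the comparison.
  have hlin : Real.sqrt 2 / 2 * (1 + (u - Real.pi / 2 - Real.pi / 4)) < 0.67 * (1.4 - y) := by
    have h10 : 1 + (u - Real.pi / 2 - Real.pi / 4) ≤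
        (Real.pi - 1) / 2 * (1 + 5 / 4 * -c) + 1 - 3 / 4 * Real.pi := by linarith
    have h11 : 0 ≤ 1 + (u - Real.pi / 2 - Real.pi / 4) := by linarith
    have h12 : Real.sqrt 2 / 2 * (1 + (u - Real.pi / 2 - Real.pi / 4)) ≤
        1.415 / 2 * ((Real.pi - 1) / 2 * (1 + 5 / 4 * -c) + 1 - 3 / 4 * Real.pi) := by
      apply mul_le_mul _ h10 h11 (by norm_num)
      linarith
    have h13 : y ≤ (Real.pi - 1) / 2 * (3 / 4 * (2.016 - 1.75 * -c)) :=
      hy.trans (mul_le_mul_of_nonneg_left (by linarith) (by linarith))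
    have h14 : Real.pi / 2 < (Real.pi - 1) / 2 * (1 + 5 / 4 * -c) := by linarith
    have h15 : 0 ≤ (3.15 - Real.pi) * -c := mul_nonneg (by linarith) (by linarith)
    have h16 : 0 ≤ (Real.pi - 3.14) * -c := mul_nonneg (by linarith) (by linarith)
    nlinarith
  have hfin : -Real.cos u < Real.exp (-y) := by linarith
  calc Real.exp y * -Real.cos u < Real.exp y * Real.exp (-y) :=
        mul_lt_mul_of_pos_left hfin (Real.exp_pos _)
    _ = 1 := by rw [← Real.exp_add]; simp

section Mesh

variable {N : ℕ} {ε lam : ℝ}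

lemma lam_pos_lt_one (hN : 1 ≤ N) (h0 : 0 < ε) (h1 : ε < 1)
    (hl : lam = ε ^ (1 / (2 * (N : ℝ)))) : 0 < lam ∧ lam < 1 := by
  have : (0 : ℝ) < N := by exact_mod_cast hN
  rw [hl]
  exact ⟨Real.rpow_pos_of_pos h0 _, Real.rpow_lt_one h0.le h1 (by positivity)⟩

/-- The first breakpoint as a function of `λ`. -/
def firstPoint (lam : ℝ) : ℝ := Real.sqrt (10 / 3 * -Real.log lam)

/-- Since `|log ε| = -2N log λ`, the number `N` cancels. This is why the final constant depends on
`λ` but not separately on `N`. -/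
lemma meshPoint_zero_eq (hN : 1 ≤ N) (h0 : 0 < ε) (h1 : ε < 1)
    (hl : lam = ε ^ (1 / (2 * (N : ℝ)))) : meshPoint N ε lam 0 = firstPoint lam := by
  have : (0 : ℝ) < N := by exact_mod_cast hN
  rw [meshPoint, firstPoint, hl, Real.log_rpow h0, abs_of_neg (Real.log_neg h0 h1)]
  congr 1
  field_simp
  ring

lemma firstPoint_pos (h0 : 0 < lam) (h1 : lam < 1) : 0 < firstPoint lam := by
  have := Real.log_neg h0 h1
  exact Real.sqrt_pos.2 (by linarith)

lemma meshPoint_succ_of_lt {j : ℕ} (h : meshPoint N ε lam j < 1) :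
    meshPoint N ε lam (j + 1) = meshPoint N ε lam j + min (meshPoint N ε lam j)
      (-(8 / 3) * Real.log lam - 8 / 3 * Real.log (Real.cos (7 / 8 * meshPoint N ε lam j))) := by
  rw [meshPoint, if_pos h]

lemma meshPoint_succ_of_ge {j : ℕ} (h : 1 ≤ meshPoint N ε lam j) :
    meshPoint N ε lam (j + 1) = Real.pi := by
  rw [meshPoint, if_neg (not_lt.2 h)]

lemma cos_pos_of_lt_one {x : ℝ} (h0 : 0 < x) (h1 : x < 1) : 0 < Real.cos (7 / 8 * x) :=
  Real.cos_pos_of_mem_Ioo ⟨by linarith [Real.pi_gt_three], by linarith [Real.pi_gt_three]⟩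

lemma neg_log_lam_le_step {x : ℝ} (h0 : 0 < x) (h1 : x < 1) :
    8 / 3 * -Real.log lam ≤ -(8 / 3) * Real.log lam - 8 / 3 * Real.log (Real.cos (7 / 8 * x)) := by
  have := Real.log_nonpos (cos_pos_of_lt_one h0 h1).le (Real.cos_le_one _)
  linarith

lemma le_meshPoint (hl0 : 0 < lam) (hl1 : lam < 1) (hΦ : 0 < meshPoint N ε lam 0)
    (hπ : meshPoint N ε lam 0 < Real.pi) (j : ℕ) :
    meshPoint N ε lam 0 ≤ meshPoint N ε lam j := by
  induction j with
  | zero => exact le_rfl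
  | succ j ih =>
    rcases lt_or_ge (meshPoint N ε lam j) 1 with h | h
    · rw [meshPoint_succ_of_lt h]
      have h2 := neg_log_lam_le_step (lam := lam) (hΦ.trans_le ih) h
      have h3 := Real.log_neg hl0 hl1
      have : 0 ≤ min (meshPoint N ε lam j) (-(8 / 3) * Real.log lam -
        8 / 3 * Real.log (Real.cos (7 / 8 * meshPoint N ε lam j))) :=
        le_min (hΦ.le.trans ih) (by linarith)
      linarith
    · rw [meshPoint_succ_of_ge h]; exact hπ.le

lemma meshPoint_lt_pi (hπ : meshPoint N ε lam 0 < Real.pi) {j : ℕ} (hj : j < meshLast N ε lam) :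
    meshPoint N ε lam j < Real.pi := by
  cases j with
  | zero => exact hπ
  | succ j =>
    rcases lt_or_ge (meshPoint N ε lam j) 1 with h | h
    · rw [meshPoint_succ_of_lt h]
      -- A step at most doubles a breakpoint below `1`, so the result is below `2 < π`.
      linarith [min_le_left (meshPoint N ε lam j) (-(8 / 3) * Real.log lam -
        8 / 3 * Real.log (Real.cos (7 / 8 * meshPoint N ε lam j))), Real.pi_gt_three]
    · exact absurd (meshPoint_succ_of_ge h) (Nat.notMem_of_lt_sInf hj)

/-- The lower bound for the real part of the points in the Bernstein ellipses of the mesh. -/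
def leftBound (lam : ℝ) : ℝ := min (7 / 8 * firstPoint lam) (73 / 100)

lemma leftBound_pos (h0 : 0 < lam) (h1 : lam < 1) : 0 < leftBound lam :=
  lt_min (by linarith [firstPoint_pos h0 h1]) (by norm_num)

/-- The region in which the contour function is analytic with values under control. -/
def InRegion (lam : ℝ) (z : ℂ) : Prop :=
  leftBound lam ≤ z.re ∧ z.re ≤ Real.pi + Real.pi / 2 ∧ |z.im| ≤ 1 ∧
    lam * Real.exp |z.im| * Real.cos z.re < 1

lemma meshPoint_lt_succ (hl0 : 0 < lam) (hl1 : lam < 1) (hΦ : 0 < meshPoint N ε lam 0)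
    (hπ : meshPoint N ε lam 0 < Real.pi) {j : ℕ} (hj : j < meshLast N ε lam) :
    meshPoint N ε lam j < meshPoint N ε lam (j + 1) := by
  have hj0 := hΦ.trans_le (le_meshPoint hl0 hl1 hΦ hπ j)
  rcases lt_or_ge (meshPoint N ε lam j) 1 with h | h
  · rw [meshPoint_succ_of_lt h]
    have h2 := neg_log_lam_le_step (lam := lam) hj0 h
    have h3 := Real.log_neg hl0 hl1
    linarith [lt_min hj0 (show 0 < -(8 / 3) * Real.log lam -
        8 / 3 * Real.log (Real.cos (7 / 8 * meshPoint N ε lam j)) by linarith)]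
  · rw [meshPoint_succ_of_ge h]; exact meshPoint_lt_pi hπ hj

/-- This is what the recursion is designed for: the two entries of its minimum control the left
vertex and the height of the ellipse. The last element, of length at most `π - 1`, needs the
separate estimate `exp_mul_cos_lt_one_of_last`. -/
lemma inRegion_of_mem_ellipse (hl0 : 0 < lam) (hl1 : lam < 1)
    (hΦ : meshPoint N ε lam 0 = firstPoint lam)
    (hπ : meshPoint N ε lam 0 < Real.pi) {j : ℕ} (hj : j < meshLast N ε lam) {w : ℂ}
    (hw1 : 1 / 2 < ‖w‖) (hw2 : ‖w‖ < 2) :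
    InRegion lam (((meshPoint N ε lam j + meshPoint N ε lam (j + 1)) / 2 : ℝ) +
      ((meshPoint N ε lam (j + 1) - meshPoint N ε lam j) / 2 : ℝ) * joukowski w) := by
  obtain ⟨A, B, c, s, hre, him, hcs, hA0, hA, hB⟩ := joukowski_coordinates hw1 hw2
  have hΦ0 : 0 < meshPoint N ε lam 0 := hΦ ▸ firstPoint_pos hl0 hl1
  have hlt := meshPoint_lt_succ hl0 hl1 hΦ0 hπ hj
  have hle := le_meshPoint hl0 hl1 hΦ0 hπ j
  have hltpi := meshPoint_lt_pi hπ hj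
  have hpi := Real.pi_lt_d2
  have hpi' := Real.pi_gt_d2
  obtain ⟨hAc0, hBs⟩ := abs_mul_le_of_ellipse hcs hA0 hA hB
  obtain ⟨hAc', hAc⟩ := abs_le.1 hAc0
  unfold InRegion
  simp only [Complex.add_re, Complex.add_im, Complex.re_ofReal_mul, Complex.im_ofReal_mul,
    Complex.ofReal_re, Complex.ofReal_im, zero_add, hre, him]
  have hlb1 : leftBound lam ≤ 7 / 8 * meshPoint N ε lam 0 := hΦ ▸ min_le_left _ _
  -- `73/100` is a lower bound for `(9 - π)/8 = π - (9/8)(π - 1)`, the leftmost possible vertex of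
  -- the last ellipse.
  have hlb2 : leftBound lam ≤ 73 / 100 := min_le_right _ _
  rcases lt_or_ge (meshPoint N ε lam j) 1 with h | h
  · obtain ⟨hh, hhdef⟩ : ∃ hh, hh = min (meshPoint N ε lam j) (-(8 / 3) * Real.log lam -
        8 / 3 * Real.log (Real.cos (7 / 8 * meshPoint N ε lam j))) := ⟨_, rfl⟩
    have hsucc := meshPoint_succ_of_lt h
    rw [← hhdef] at hsucc
    rw [hsucc] at hlt ⊢
    have hh1 : hh ≤ meshPoint N ε lam j := hhdef ▸ min_le_left _ _
    have hh2 : hh ≤ -(8 / 3) * Real.log lam -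
        8 / 3 * Real.log (Real.cos (7 / 8 * meshPoint N ε lam j)) := hhdef ▸ min_le_right _ _
    clear hhdef hsucc
    set Φ := meshPoint N ε lam j
    have hh0 : 0 < hh := by linarith
    have hsub : (Φ + hh - Φ) / 2 = hh / 2 := by ring
    rw [hsub]
    have hm1 : hh * -(5 / 4) ≤ hh * (A * c) := mul_le_mul_of_nonneg_left hAc' hh0.le
    have hm2 : hh * (A * c) ≤ hh * (5 / 4) := mul_le_mul_of_nonneg_left hAc hh0.le
    -- The left vertex is `Φ + h/2 - (5/4)(h/2) = Φ - h/8`, and `h ≤ Φ`.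
    have hx1 : 7 / 8 * Φ ≤ (Φ + (Φ + hh)) / 2 + hh / 2 * (A * c) := by linarith
    have hx2 : (Φ + (Φ + hh)) / 2 + hh / 2 * (A * c) ≤ 17 / 8 := by linarith
    have hy : |hh / 2 * (B * s)| < 3 / 8 * hh := by
      rw [abs_mul, abs_of_pos (by linarith : 0 < hh / 2)]
      linarith [mul_lt_mul_of_pos_left hBs hh0]
    refine ⟨by linarith, by linarith, by linarith, ?_⟩
    have hcos := cos_pos_of_lt_one (by linarith : 0 < Φ) h
    have hcosle : Real.cos ((Φ + (Φ + hh)) / 2 + hh / 2 * (A * c)) ≤ Real.cos (7 / 8 * Φ) :=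
      Real.cos_le_cos_of_nonneg_of_le_pi (by linarith) (by linarith) hx1
    -- The imaginary part is below `(3/4)(h/2) = 3h/8`, which the second entry of the minimum bounds
    -- by `-log λ - log cos (7Φ/8)`.
    have hexp : Real.exp |hh / 2 * (B * s)| < lam⁻¹ * (Real.cos (7 / 8 * Φ))⁻¹ := by
      rw [← Real.exp_log (show 0 < lam⁻¹ * (Real.cos (7 / 8 * Φ))⁻¹ by positivity),
        Real.exp_lt_exp, Real.log_mul (by positivity) (by positivity), Real.log_inv, Real.log_inv]
      linarith
    calc _ ≤ lam * Real.exp |hh / 2 * (B * s)| * Real.cos (7 / 8 * Φ) :=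
          mul_le_mul_of_nonneg_left hcosle (by positivity)
      _ < lam * (lam⁻¹ * (Real.cos (7 / 8 * Φ))⁻¹) * Real.cos (7 / 8 * Φ) :=
          mul_lt_mul_of_pos_right (mul_lt_mul_of_pos_left hexp hl0) hcos
      _ = 1 := by
          have := hcos.ne'
          rw [mul_inv_cancel_left₀ hl0.ne', inv_mul_cancel₀ this]
  · rw [meshPoint_succ_of_ge h]
    obtain ⟨hh, hhdef⟩ : ∃ hh, hh = Real.pi - meshPoint N ε lam j := ⟨_, rfl⟩
    have hcenter : (meshPoint N ε lam j + Real.pi) / 2 = Real.pi - hh / 2 := by rw [hhdef]; ring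
    rw [hcenter, ← hhdef]
    have hh0 : 0 < hh := by linarith
    have key := exp_mul_cos_lt_one_of_last hh0 (by linarith) hcs hA0 hA hB
    have hm1 : hh * -(5 / 4) ≤ hh * (A * c) := mul_le_mul_of_nonneg_left hAc' hh0.le
    have hm2 : hh * (A * c) ≤ hh * (5 / 4) := mul_le_mul_of_nonneg_left hAc hh0.le
    refine ⟨by linarith, by linarith, ?_, ?_⟩
    · rw [abs_mul, abs_of_pos (by linarith : 0 < hh / 2)]
      linarith [mul_lt_mul_of_pos_left hBs hh0]
    · rw [mul_assoc]
      exact (mul_lt_mul_of_pos_left key hl0).trans (by linarith)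

/-- The argument of the symbol along the contour. -/
def contourArg (lam : ℝ) (z : ℂ) : ℂ := 1 - (lam : ℂ) * Complex.exp (-(z * Complex.I))

lemma contourArg_re (lam : ℝ) (z : ℂ) :
    (contourArg lam z).re = 1 - lam * Real.exp z.im * Real.cos z.re := by
  simp [contourArg, Complex.exp_re]; ring

lemma contourArg_im (lam : ℝ) (z : ℂ) :
    (contourArg lam z).im = lam * Real.exp z.im * Real.sin z.re := by
  simp [contourArg, Complex.exp_im]; ring

lemma InRegion.re_contourArg_pos {z : ℂ} (hl0 : 0 < lam) (h : InRegion lam z) :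
    0 < (contourArg lam z).re := by
  obtain ⟨-, -, -, h4⟩ := h
  rw [contourArg_re]
  rcases le_or_gt (Real.cos z.re) 0 with hc | hc
  · have := mul_nonpos_of_nonneg_of_nonpos (mul_pos hl0 (Real.exp_pos z.im)).le hc
    linarith
  · have : lam * Real.exp z.im * Real.cos z.re ≤ lam * Real.exp |z.im| * Real.cos z.re := by
      gcongr; exact le_abs_self _
    linarith

lemma InRegion.norm_contourArg_le {z : ℂ} (hl0 : 0 < lam) (hl1 : lam < 1) (h : InRegion lam z) :
    ‖contourArg lam z‖ ≤ 4 := by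
  obtain ⟨-, -, h3, -⟩ := h
  refine (norm_sub_le _ _).trans ?_
  rw [norm_mul, Complex.norm_exp, Complex.norm_real, Real.norm_of_nonneg hl0.le, norm_one]
  have h1 : (-(z * Complex.I)).re = z.im := by simp
  rw [h1]
  have h2 : Real.exp z.im ≤ 3 :=
    (Real.exp_le_exp.2 ((le_abs_self _).trans h3)).trans Real.exp_one_lt_three.le
  nlinarith [Real.exp_pos z.im]

/-- With `ρ = λ e^(Im z)` and `x = Re z`, the squared modulus is `(ρ - cos x)² + sin² x`, hence at
least `sin² x`. Where `cos x ≤ 0` the real part alone is at least `1`. -/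
lemma InRegion.le_norm_contourArg {z : ℂ} (hl0 : 0 < lam) (hl1 : lam < 1) (h : InRegion lam z) :
    Real.sin (leftBound lam) ≤ ‖contourArg lam z‖ := by
  have hre := h.re_contourArg_pos hl0
  obtain ⟨h1, h2, -, -⟩ := h
  have hpos := leftBound_pos hl0 hl1
  rcases le_or_gt (Real.cos z.re) 0 with hc | hc
  · have h5 := mul_nonpos_of_nonneg_of_nonpos (mul_pos hl0 (Real.exp_pos z.im)).le hc
    have h6 := Complex.re_le_norm (contourArg lam z)
    rw [contourArg_re] at h6
    linarith [Real.sin_le_one (leftBound lam)]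
  · have hx : z.re < Real.pi / 2 := by
      by_contra hcon
      exact absurd (Real.cos_nonpos_of_pi_div_two_le_of_le (not_lt.1 hcon) h2) (not_le.2 hc)
    have hs : Real.sin (leftBound lam) ≤ Real.sin z.re :=
      Real.sin_le_sin_of_le_of_le_pi_div_two (by linarith) hx.le h1
    have hs0 : 0 < Real.sin (leftBound lam) :=
      Real.sin_pos_of_pos_of_lt_pi hpos (by linarith [Real.pi_pos])
    refine hs.trans (Real.le_sqrt_of_sq_le ?_ |>.trans_eq (Complex.norm_eq_sqrt_sq_add_sq _).symm)
    rw [contourArg_re, contourArg_im]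
    nlinarith [Real.sin_sq_add_cos_sq z.re, sq_nonneg (lam * Real.exp z.im - Real.cos z.re)]

lemma InRegion.conj {z : ℂ} (h : InRegion lam z) : InRegion lam ((starRingEnd ℂ) z) := by
  simpa [InRegion] using h

lemma contourArg_two_pi_sub (lam : ℝ) (z : ℂ) :
    contourArg lam (2 * Real.pi - z) = (starRingEnd ℂ) (contourArg lam ((starRingEnd ℂ) z)) := by
  apply Complex.ext
  · rw [Complex.conj_re, contourArg_re, contourArg_re]
    have h1 : (2 * (Real.pi : ℂ) - z).re = 2 * Real.pi - z.re := by simp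
    have h2 : (2 * (Real.pi : ℂ) - z).im = -z.im := by simp
    rw [h1, h2, Complex.conj_re, Complex.conj_im, Real.cos_two_pi_sub]
  · rw [Complex.conj_im, contourArg_im, contourArg_im]
    have h1 : (2 * (Real.pi : ℂ) - z).re = 2 * Real.pi - z.re := by simp
    have h2 : (2 * (Real.pi : ℂ) - z).im = -z.im := by simp
    rw [h1, h2, Complex.conj_re, Complex.conj_im, Real.sin_two_pi_sub]; ring

/-- On the Bernstein ellipses of all elements in which one interpolates, the argument of the
symbol stays in the right half-plane, bounded and away from `0`. -/
theorem contourArg_mem_of_ellipse (hl0 : 0 < lam) (hl1 : lam < 1)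
    (hΦ : meshPoint N ε lam 0 = firstPoint lam) (hπ : meshPoint N ε lam 0 < Real.pi) {k : ℕ}
    (hk0 : k ≠ 0) (hk : k < 2 * meshLast N ε lam + 1) :
    elemLeft N ε lam k < elemRight N ε lam k ∧ ∀ w : ℂ, 1 / 2 < ‖w‖ → ‖w‖ < 2 →
      let z := (((elemLeft N ε lam k + elemRight N ε lam k) / 2 : ℝ) : ℂ) +
        ((elemRight N ε lam k - elemLeft N ε lam k) / 2 : ℝ) * joukowski w
      0 < (contourArg lam z).re ∧ ‖contourArg lam z‖ ≤ 4 ∧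
        Real.sin (leftBound lam) ≤ ‖contourArg lam z‖ := by
  have hΦ0 : 0 < meshPoint N ε lam 0 := hΦ ▸ firstPoint_pos hl0 hl1
  -- Elements left of `π` are treated directly, the others by reflection. Termination of the
  -- recursion is not needed: were `π` never reached, `meshLast` would be `0` and there would be no
  -- such `k`.
  rcases le_or_gt k (meshLast N ε lam) with h | h
  · obtain ⟨j, rfl⟩ := Nat.exists_eq_succ_of_ne_zero hk0
    simp only [elemLeft, elemRight, if_pos h, Nat.succ_eq_add_one, meshPred]
    refine ⟨meshPoint_lt_succ hl0 hl1 hΦ0 hπ h, fun w h1 h2 => ?_⟩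
    have hz := inRegion_of_mem_ellipse hl0 hl1 hΦ hπ (j := j) h h1 h2
    exact ⟨hz.re_contourArg_pos hl0, hz.norm_contourArg_le hl0 hl1, hz.le_norm_contourArg hl0 hl1⟩
  · obtain ⟨j, hj⟩ : ∃ j, 2 * meshLast N ε lam + 1 - k = j + 1 :=
      Nat.exists_eq_succ_of_ne_zero (by omega)
    have hjM : j < meshLast N ε lam := by omega
    simp only [elemLeft, elemRight, if_neg (not_le.2 h), hj, meshPred]
    refine ⟨by linarith [meshPoint_lt_succ hl0 hl1 hΦ0 hπ hjM], fun w h1 h2 => ?_⟩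
    -- Reflection `z ↦ 2π - z` reverses the element, which is matched by `w ↦ -w` because the
    -- Joukowski map is odd; the symbol argument changes by conjugations.
    have hz := (inRegion_of_mem_ellipse hl0 hl1 hΦ hπ hjM (w := -w)
      (by rwa [norm_neg]) (by rwa [norm_neg])).conj
    set ζ : ℂ := (((meshPoint N ε lam j + meshPoint N ε lam (j + 1)) / 2 : ℝ) : ℂ) +
      ((meshPoint N ε lam (j + 1) - meshPoint N ε lam j) / 2 : ℝ) * joukowski (-w) with hζ
    have hzeq : (((2 * Real.pi - meshPoint N ε lam (j + 1) +
        (2 * Real.pi - meshPoint N ε lam j)) / 2 : ℝ) : ℂ) +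
        ((2 * Real.pi - meshPoint N ε lam j -
          (2 * Real.pi - meshPoint N ε lam (j + 1))) / 2 : ℝ) * joukowski w =
        2 * Real.pi - ζ := by
      rw [hζ, joukowski, joukowski, inv_neg]; push_cast; ring
    rw [hzeq, contourArg_two_pi_sub, Complex.norm_conj, Complex.conj_re]
    exact ⟨hz.re_contourArg_pos hl0, hz.norm_contourArg_le hl0 hl1, hz.le_norm_contourArg hl0 hl1⟩

end Mesh

/-! ### Discrete Fourier transforms of vectors in a Hilbert space -/

lemma sum_zpow_pow_primitiveRoot {ζ : ℂ} {L : ℕ} (hζ : IsPrimitiveRoot ζ L) (a : ℤ) :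
    ∑ l ∈ Finset.range L, (ζ ^ a) ^ l = if (L : ℤ) ∣ a then (L : ℂ) else 0 := by
  split_ifs with h
  · rw [(hζ.zpow_eq_one_iff_dvd a).2 h]; simp
  · have h1 : ζ ^ a ≠ 1 := fun h' => h ((hζ.zpow_eq_one_iff_dvd a).1 h')
    have h2 : (ζ ^ a) ^ L = 1 := by
      rw [← zpow_natCast, zpow_comm, zpow_natCast, hζ.pow_eq_one, one_zpow]
    rw [geom_sum_eq h1, h2]; simp

section Parseval

variable {Y : Type*} [NormedAddCommGroup Y] [InnerProductSpace ℂ Y]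

theorem sum_norm_sq_dft {ζ : ℂ} {L : ℕ} (hL : L ≠ 0) (hζ : IsPrimitiveRoot ζ L) (v : ℕ → Y) :
    ∑ n ∈ Finset.range L, ‖∑ l ∈ Finset.range L, ζ ^ (l * n) • v l‖ ^ 2 =
      L * ∑ l ∈ Finset.range L, ‖v l‖ ^ 2 := by
  have hz0 : ζ ≠ 0 := hζ.ne_zero hL
  have hconj : (starRingEnd ℂ) ζ = ζ⁻¹ := by
    rw [Complex.inv_def, Complex.normSq_eq_norm_sq, hζ.norm'_eq_one hL]; simp
  have key : ∀ n, ((‖∑ l ∈ Finset.range L, ζ ^ (l * n) • v l‖ ^ 2 : ℝ) : ℂ) =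
      ∑ l ∈ Finset.range L, ∑ k ∈ Finset.range L,
        (ζ ^ ((k : ℤ) - l)) ^ n * inner ℂ (v l) (v k) := by
    intro n
    push_cast
    refine (inner_self_eq_norm_sq_to_K (𝕜 := ℂ) (∑ l ∈ Finset.range L, ζ ^ (l * n) • v l)).symm.trans ?_
    rw [sum_inner]
    refine Finset.sum_congr rfl fun l _ => ?_
    rw [inner_sum]
    refine Finset.sum_congr rfl fun k _ => ?_
    rw [inner_smul_left, inner_smul_right, map_pow, hconj, zpow_sub₀ hz0, zpow_natCast,
      zpow_natCast, div_pow, ← pow_mul, ← pow_mul, inv_pow]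
    ring
  apply Complex.ofReal_injective
  rw [Complex.ofReal_sum]
  simp only [key]
  rw [Finset.sum_comm]
  push_cast
  rw [Finset.mul_sum]
  refine Finset.sum_congr rfl fun l hl => ?_
  rw [Finset.sum_comm, Finset.sum_eq_single l]
  · rw [← Finset.sum_mul, sum_zpow_pow_primitiveRoot hζ]
    simp [inner_self_eq_norm_sq_to_K]
  · intro k hk hkl
    rw [← Finset.sum_mul, sum_zpow_pow_primitiveRoot hζ, if_neg, zero_mul]
    intro hdvd
    rw [Finset.mem_range] at hl hk
    have := Int.eq_zero_of_abs_lt_dvd hdvd (by rw [abs_lt]; constructor <;> omega)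
    omega
  · exact fun h => absurd hl h

/-- For `N = L` there is one frequency more than a period. By periodicity the last one repeats an
earlier one, at the cost of a factor `2`. -/
lemma sum_norm_sq_dft_le {ζ : ℂ} {N L : ℕ} (hL : L ≠ 0) (hNL : N ≤ L) (hζ : IsPrimitiveRoot ζ L)
    (v : ℕ → Y) :
    ∑ n ∈ Finset.range (N + 1), ‖∑ l ∈ Finset.range L, ζ ^ (l * n) • v l‖ ^ 2 ≤
      2 * L * ∑ l ∈ Finset.range L, ‖v l‖ ^ 2 := by
  have h1 := sum_norm_sq_dft hL hζ v
  have h2 : ∑ n ∈ Finset.range N, ‖∑ l ∈ Finset.range L, ζ ^ (l * n) • v l‖ ^ 2 ≤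
      ∑ n ∈ Finset.range L, ‖∑ l ∈ Finset.range L, ζ ^ (l * n) • v l‖ ^ 2 :=
    Finset.sum_le_sum_of_subset_of_nonneg (Finset.range_mono hNL) fun _ _ _ => by positivity
  have h3 : ‖∑ l ∈ Finset.range L, ζ ^ (l * N) • v l‖ ^ 2 ≤
      ∑ n ∈ Finset.range L, ‖∑ l ∈ Finset.range L, ζ ^ (l * n) • v l‖ ^ 2 := by
    have e : ∑ l ∈ Finset.range L, ζ ^ (l * N) • v l =
        ∑ l ∈ Finset.range L, ζ ^ (l * (N % L)) • v l := by
      refine Finset.sum_congr rfl fun l _ => ?_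
      congr 1
      rw [mul_comm l, mul_comm l, pow_mul, pow_mul, pow_eq_pow_mod N hζ.pow_eq_one]
    rw [e]
    exact Finset.single_le_sum (f := fun n => ‖∑ l ∈ Finset.range L, ζ ^ (l * n) • v l‖ ^ 2)
      (fun _ _ => by positivity) (Finset.mem_range.2 (Nat.mod_lt _ (Nat.pos_of_ne_zero hL)))
  rw [Finset.sum_range_succ]
  linarith

/-- The entry `h N` may overflow the period, so it is split off with `(a + b)² ≤ 2a² + 2b²` before
Parseval is applied. -/
lemma sum_norm_sq_dft_le' {ζ : ℂ} {N L : ℕ} (hL : L ≠ 0) (hNL : N ≤ L) (hζ : IsPrimitiveRoot ζ L)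
    (h : ℕ → Y) :
    ∑ l ∈ Finset.range L, ‖∑ j ∈ Finset.range (N + 1), ζ ^ (j * l) • h j‖ ^ 2 ≤
      2 * L * ∑ j ∈ Finset.range (N + 1), ‖h j‖ ^ 2 := by
  have hnorm : ‖ζ‖ = 1 := hζ.norm'_eq_one hL
  have h1 := sum_norm_sq_dft hL hζ (fun j => if j < N then h j else 0)
  have e1 : ∀ l, ∑ j ∈ Finset.range L, ζ ^ (j * l) • (if j < N then h j else 0) =
      ∑ j ∈ Finset.range N, ζ ^ (j * l) • h j := by
    intro l
    symm
    refine Finset.sum_subset_zero_on_sdiff (Finset.range_mono hNL) ?_ ?_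
    · intro j hj; simp at hj; rw [if_neg (by omega), smul_zero]
    · intro j hj; rw [if_pos (by simpa using hj)]
  have e2 : ∑ j ∈ Finset.range L, ‖if j < N then h j else 0‖ ^ 2 =
      ∑ j ∈ Finset.range N, ‖h j‖ ^ 2 := by
    symm
    refine Finset.sum_subset_zero_on_sdiff (Finset.range_mono hNL) ?_ ?_
    · intro j hj; simp at hj; rw [if_neg (by omega)]; simp
    · intro j hj; rw [if_pos (by simpa using hj)]
  simp only [e1] at h1
  rw [e2] at h1
  calc _ ≤ ∑ l ∈ Finset.range L,
        (2 * ‖∑ j ∈ Finset.range N, ζ ^ (j * l) • h j‖ ^ 2 + 2 * ‖h N‖ ^ 2) := by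
        refine Finset.sum_le_sum fun l _ => ?_
        rw [Finset.sum_range_succ]
        have h2 := norm_add_le (∑ j ∈ Finset.range N, ζ ^ (j * l) • h j) (ζ ^ (N * l) • h N)
        rw [norm_smul (ζ ^ (N * l)), norm_pow, hnorm, one_pow, one_mul] at h2
        refine (pow_le_pow_left₀ (norm_nonneg _) h2 2).trans ?_
        nlinarith [sq_nonneg (‖∑ j ∈ Finset.range N, ζ ^ (j * l) • h j‖ - ‖h N‖)]
    _ = _ := by
        rw [Finset.sum_add_distrib, ← Finset.mul_sum, h1, Finset.sum_range_succ]
        simp; ring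

end Parseval

lemma rootL_isPrimitiveRoot {L : ℕ} (hL : L ≠ 0) : IsPrimitiveRoot (rootL L) L :=
  Complex.isPrimitiveRoot_exp L hL

/-! ### Multipliers in scaled Fourier space -/

section Operators

variable {X : Type*} [NormedAddCommGroup X] [InnerProductSpace ℂ X]
  {Y : Type*} [NormedAddCommGroup Y] [InnerProductSpace ℂ Y]

/-- The inverse of the scaled discrete Fourier transform, applied to operators acting on the
scaled discrete Fourier transform of `g`. -/
def scaledMultiplier (N L : ℕ) (lam : ℝ) (E : ℕ → X →L[ℂ] Y) (g : ℕ → X) (n : ℕ) : Y :=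
  (((lam : ℂ) ^ n)⁻¹ / (L : ℂ)) • ∑ l ∈ Finset.range L,
    (rootL L ^ (l * n)) • E l (scaledDFT N L lam g l)

lemma sum_norm_sq_scaledDFT_le {N L : ℕ} {lam : ℝ} (hL : L ≠ 0) (hNL : N ≤ L) (h0 : 0 < lam)
    (h1 : lam < 1) (g : ℕ → X) :
    ∑ l ∈ Finset.range L, ‖scaledDFT N L lam g l‖ ^ 2 ≤
      2 * L * ∑ j ∈ Finset.range (N + 1), ‖g j‖ ^ 2 := by
  have h2 := sum_norm_sq_dft_le' hL hNL (rootL_isPrimitiveRoot hL).inv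
    (fun j => ((lam : ℂ) ^ j) • g j)
  have e : ∀ l, scaledDFT N L lam g l =
      ∑ j ∈ Finset.range (N + 1), (rootL L)⁻¹ ^ (j * l) • ((lam : ℂ) ^ j) • g j := by
    intro l
    refine Finset.sum_congr rfl fun j _ => ?_
    rw [smul_smul, inv_pow, mul_comm]
  simp only [← e] at h2
  refine h2.trans (mul_le_mul_of_nonneg_left (Finset.sum_le_sum fun j _ => ?_) (by positivity))
  rw [norm_smul, norm_pow, Complex.norm_real, Real.norm_of_nonneg h0.le]
  exact pow_le_pow_left₀ (by positivity)
    (mul_le_of_le_one_left (norm_nonneg _) (pow_le_one₀ h0.le h1.le)) 2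

theorem sum_norm_sq_scaledMultiplier_le {N L : ℕ} {lam δ : ℝ} (hL : L ≠ 0) (hNL : N ≤ L)
    (h0 : 0 < lam) (h1 : lam < 1) {E : ℕ → X →L[ℂ] Y} (hE : ∀ l < L, ‖E l‖ ≤ δ)
    (g : ℕ → X) :
    ∑ n ∈ Finset.range (N + 1), ‖scaledMultiplier N L lam E g n‖ ^ 2 ≤
      (2 * δ * (lam ^ N)⁻¹) ^ 2 * ∑ j ∈ Finset.range (N + 1), ‖g j‖ ^ 2 := by
  have hLpos : (0 : ℝ) < L := by exact_mod_cast Nat.pos_of_ne_zero hL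
  have h2 := sum_norm_sq_dft_le hL hNL (rootL_isPrimitiveRoot hL)
    (fun l => E l (scaledDFT N L lam g l))
  have h3 : ∑ l ∈ Finset.range L, ‖E l (scaledDFT N L lam g l)‖ ^ 2 ≤
      δ ^ 2 * (2 * L * ∑ j ∈ Finset.range (N + 1), ‖g j‖ ^ 2) := by
    refine le_trans ?_ (mul_le_mul_of_nonneg_left (sum_norm_sq_scaledDFT_le hL hNL h0 h1 g)
      (sq_nonneg δ))
    rw [Finset.mul_sum]
    refine Finset.sum_le_sum fun l hl => ?_
    rw [← mul_pow]
    exact pow_le_pow_left₀ (norm_nonneg _) (((E l).le_opNorm _).trans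
      (mul_le_mul_of_nonneg_right (hE l (Finset.mem_range.1 hl)) (norm_nonneg _))) 2
  calc _ ≤ ∑ n ∈ Finset.range (N + 1), ((lam ^ N)⁻¹ / L) ^ 2 *
        ‖∑ l ∈ Finset.range L, rootL L ^ (l * n) • E l (scaledDFT N L lam g l)‖ ^ 2 := by
        refine Finset.sum_le_sum fun n hn => ?_
        rw [scaledMultiplier, norm_smul, mul_pow]
        refine mul_le_mul_of_nonneg_right (pow_le_pow_left₀ (norm_nonneg _) ?_ 2) (by positivity)
        rw [norm_div, norm_inv, norm_pow, Complex.norm_real, Real.norm_of_nonneg h0.le,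
          Complex.norm_natCast]
        have : lam ^ N ≤ lam ^ n :=
          pow_le_pow_of_le_one h0.le h1.le (Nat.lt_succ_iff.1 (Finset.mem_range.1 hn))
        gcongr
    _ ≤ ((lam ^ N)⁻¹ / L) ^ 2 * (2 * L * (δ ^ 2 *
          (2 * L * ∑ j ∈ Finset.range (N + 1), ‖g j‖ ^ 2))) := by
        rw [← Finset.mul_sum]
        exact mul_le_mul_of_nonneg_left (h2.trans
          (mul_le_mul_of_nonneg_left h3 (by positivity))) (by positivity)
    _ = _ := by field_simp

end Operators

/-! ### Bounds for the convolution quadrature weights -/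

/-- The squared distance is `(1 - r)² + 4r sin² (θ/2)`, at least `sin² (θ/2)` for these radii;
Jordan's inequality then gives a linear lower bound, independent of `r`. -/
lemma le_norm_one_sub_circleMap {r θ : ℝ} (hr : 1 / 2 ≤ r) (h0 : 0 ≤ θ)
    (h1 : θ ≤ 2 * Real.pi) : min θ (2 * Real.pi - θ) / Real.pi ≤ ‖1 - circleMap 0 r θ‖ := by
  have hpi := Real.pi_pos
  have hre : (1 - circleMap 0 r θ).re = 1 - r * Real.cos θ := by
    simp [circleMap, Complex.exp_re]
  have him : (1 - circleMap 0 r θ).im = -(r * Real.sin θ) := by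
    simp [circleMap, Complex.exp_im]
  have hs : min θ (2 * Real.pi - θ) / Real.pi ≤ Real.sin (θ / 2) := by
    rcases le_total θ Real.pi with h | h
    · have := Real.mul_le_sin (x := θ / 2) (by linarith) (by linarith)
      refine (div_le_div_of_nonneg_right (min_le_left _ _) hpi.le).trans (le_trans ?_ this)
      apply le_of_eq; field_simp
    · have := Real.mul_le_sin (x := Real.pi - θ / 2) (by linarith) (by linarith)
      rw [Real.sin_pi_sub] at this
      refine (div_le_div_of_nonneg_right (min_le_right _ _) hpi.le).trans (le_trans ?_ this)
      apply le_of_eq; field_simp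
  have hs0 : 0 ≤ min θ (2 * Real.pi - θ) / Real.pi :=
    div_nonneg (le_min h0 (by linarith)) hpi.le
  rw [Complex.norm_eq_sqrt_sq_add_sq, hre, him]
  refine Real.le_sqrt_of_sq_le ((pow_le_pow_left₀ hs0 hs 2).trans ?_)
  have hc : Real.cos θ = 1 - 2 * Real.sin (θ / 2) ^ 2 := by
    rw [show θ = 2 * (θ / 2) by ring, Real.cos_two_mul, show 2 * (θ / 2) / 2 = θ / 2 by ring]
    linarith [Real.sin_sq_add_cos_sq (θ / 2)]
  have h2 := Real.sin_sq_add_cos_sq θ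
  have h3 : (1 - r * Real.cos θ) ^ 2 + (-(r * Real.sin θ)) ^ 2 =
      (1 - r) ^ 2 + 2 * r * (1 - Real.cos θ) := by
    have : Real.sin θ ^ 2 = 1 - Real.cos θ ^ 2 := by linarith
    rw [neg_sq, mul_pow, this]; ring
  rw [h3, hc]
  nlinarith [sq_nonneg (1 - r), sq_nonneg (Real.sin (θ / 2))]

lemma norm_one_sub_circleMap_pos {r : ℝ} (hr0 : 0 ≤ r) (hr1 : r < 1) (θ : ℝ) :
    0 < ‖1 - circleMap 0 r θ‖ := by
  have h1 : ‖circleMap 0 r θ‖ = r := by simp [circleMap, abs_of_nonneg hr0]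
  have h2 := norm_sub_norm_le (1 : ℂ) (circleMap 0 r θ)
  rw [norm_one, h1] at h2
  linarith

/-- The mean of `|1 - ζ|^μ` on the circles `|ζ| = r` is bounded for `r < 1` if `μ > -1`. -/
lemma exists_integral_rpow_le {μ : ℝ} (hμ : -1 < μ) :
    ∃ A : ℝ, 0 < A ∧ ∀ r : ℝ, 1 / 2 ≤ r → r < 1 →
      (2 * Real.pi)⁻¹ * ∫ θ in (0 : ℝ)..2 * Real.pi, ‖1 - circleMap 0 r θ‖ ^ μ ≤ A := by
  have hpi := Real.pi_pos
  have hint : ∀ r : ℝ, 0 ≤ r → r < 1 → IntervalIntegrable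
      (fun θ => ‖1 - circleMap 0 r θ‖ ^ μ) MeasureTheory.volume 0 (2 * Real.pi) := by
    intro r h0 h1
    refine Continuous.intervalIntegrable ?_ _ _
    refine Continuous.rpow_const (continuous_const.sub (continuous_circleMap 0 r)).norm ?_
    exact fun θ => Or.inl (norm_one_sub_circleMap_pos h0 h1 θ).ne'
  rcases le_or_gt 0 μ with h | h
  · refine ⟨2 ^ μ, by positivity, fun r hr0 hr1 => ?_⟩
    have h1 : ∫ θ in (0 : ℝ)..2 * Real.pi, ‖1 - circleMap 0 r θ‖ ^ μ ≤
        ∫ θ in (0 : ℝ)..2 * Real.pi, (2 : ℝ) ^ μ := by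
      refine intervalIntegral.integral_mono_on (by positivity) (hint r (by linarith) hr1)
        (by simp) fun θ _ => ?_
      refine Real.rpow_le_rpow (norm_nonneg _) ((norm_sub_le _ _).trans ?_) h
      have h1 : ‖circleMap 0 r θ‖ = r := by
        simp [circleMap, abs_of_nonneg (by linarith : 0 ≤ r)]
      rw [h1, norm_one]; linarith
    calc _ ≤ (2 * Real.pi)⁻¹ * ∫ θ in (0 : ℝ)..2 * Real.pi, (2 : ℝ) ^ μ := by gcongr
      _ = 2 ^ μ := by simp; field_simp
  · have hi1 : IntervalIntegrable (fun θ : ℝ => θ ^ μ) MeasureTheory.volume 0 (2 * Real.pi) :=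
      intervalIntegral.intervalIntegrable_rpow' hμ
    have hi2 : IntervalIntegrable (fun θ : ℝ => (2 * Real.pi - θ) ^ μ) MeasureTheory.volume 0
        (2 * Real.pi) := by
      have := (hi1.comp_sub_left (2 * Real.pi)).symm
      simpa using this
    -- A majorant independent of `r`, integrable at both end points because `μ > -1`. The `1` added
    -- to it below only makes the constant positive.
    set I := ∫ θ in (0 : ℝ)..2 * Real.pi, (Real.pi ^ μ)⁻¹ * (θ ^ μ + (2 * Real.pi - θ) ^ μ) with hI
    refine ⟨(2 * Real.pi)⁻¹ * I + 1, ?_, fun r hr0 hr1 => ?_⟩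
    · have : 0 ≤ I := intervalIntegral.integral_nonneg (by positivity) fun θ hθ => by
        have := hθ.1
        have : 0 ≤ 2 * Real.pi - θ := by linarith [hθ.2]
        positivity
      positivity
    · have : ∫ θ in (0 : ℝ)..2 * Real.pi, ‖1 - circleMap 0 r θ‖ ^ μ ≤ I := by
        refine intervalIntegral.integral_mono_on_of_le_Ioo (by positivity)
          (hint r (by linarith) hr1) ((hi1.add hi2).const_mul _) fun θ hθ => ?_
        have h1 : 0 < θ := hθ.1
        have h2 : 0 < 2 * Real.pi - θ := by linarith [hθ.2]
        have hm : 0 < min θ (2 * Real.pi - θ) := lt_min h1 h2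
        calc _ ≤ (min θ (2 * Real.pi - θ) / Real.pi) ^ μ :=
              Real.rpow_le_rpow_of_nonpos (by positivity)
                (le_norm_one_sub_circleMap hr0 h1.le hθ.2.le) h.le
          _ = (Real.pi ^ μ)⁻¹ * min θ (2 * Real.pi - θ) ^ μ := by
              rw [Real.div_rpow hm.le hpi.le]; ring
          _ ≤ _ := by
              refine mul_le_mul_of_nonneg_left ?_ (by positivity)
              rcases min_choice θ (2 * Real.pi - θ) with h3 | h3 <;> rw [h3]
              · linarith [Real.rpow_nonneg h2.le μ]
              · linarith [Real.rpow_nonneg h1.le μ]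
      have : (2 * Real.pi)⁻¹ * ∫ θ in (0 : ℝ)..2 * Real.pi, ‖1 - circleMap 0 r θ‖ ^ μ ≤
          (2 * Real.pi)⁻¹ * I := mul_le_mul_of_nonneg_left this (by positivity)
      linarith

section Weights

variable {E : Type*} [NormedAddCommGroup E] {K : ℂ → E}
  {M₀ μ τ : ℝ}

lemma norm_symbol_le (hb : ∀ s : ℂ, 0 < s.re → ‖K s‖ ≤ M₀ * ‖s‖ ^ μ) (hτ : 0 < τ) {w : ℂ}
    (hw : 0 < w.re) : ‖K (w / τ)‖ ≤ M₀ * τ ^ (-μ) * ‖w‖ ^ μ := by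
  refine (hb _ ?_).trans_eq ?_
  · rw [Complex.div_ofReal_re]; positivity
  · rw [norm_div, Complex.norm_real, Real.norm_of_nonneg hτ.le,
      Real.div_rpow (norm_nonneg _) hτ.le, Real.rpow_neg hτ.le]
    ring

lemma symbolBound_nonneg (hb : ∀ s : ℂ, 0 < s.re → ‖K s‖ ≤ M₀ * ‖s‖ ^ μ) : 0 ≤ M₀ := by
  have := (norm_nonneg _).trans (hb 1 (by simp))
  simpa using this

variable [NormedSpace ℂ E]

lemma differentiableAt_symbol (hK : DifferentiableOn ℂ K {s : ℂ | 0 < s.re}) (hτ : 0 < τ)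
    {w : ℂ} (hw : 0 < w.re) : DifferentiableAt ℂ (fun w : ℂ => K (w / τ)) w := by
  have hopen : IsOpen {s : ℂ | 0 < s.re} := isOpen_lt continuous_const Complex.continuous_re
  have hmem : w / τ ∈ {s : ℂ | 0 < s.re} := by
    rw [Set.mem_ofPred_eq, Complex.div_ofReal_re]; positivity
  exact (hK.differentiableAt (hopen.mem_nhds hmem)).comp w
    (f := fun w : ℂ => w / τ) (differentiableAt_id.div_const _)

lemma re_eulerGen_pos {ζ : ℂ} (h : ‖ζ‖ < 1) : 0 < (eulerGen ζ).re := by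
  have := Complex.re_le_norm ζ
  simp only [eulerGen, Complex.sub_re, Complex.one_re]
  linarith

lemma differentiableOn_symbol_eulerGen (hK : DifferentiableOn ℂ K {s : ℂ | 0 < s.re})
    (hτ : 0 < τ) :
    DifferentiableOn ℂ (fun ζ : ℂ => K (eulerGen ζ / (τ : ℂ))) (Metric.ball 0 1) := by
  intro ζ hζ
  have h1 := differentiableAt_symbol hK hτ (re_eulerGen_pos (by simpa using hζ))
  exact (h1.comp ζ (f := eulerGen) (by unfold eulerGen; fun_prop)).differentiableWithinAt

variable [CompleteSpace E]

lemma hasSum_cqWeight (hK : DifferentiableOn ℂ K {s : ℂ | 0 < s.re}) (hτ : 0 < τ) {ζ : ℂ}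
    (hζ : ‖ζ‖ < 1) :
    HasSum (fun m => ζ ^ m • cqWeight K τ m) (K (eulerGen ζ / (τ : ℂ))) := by
  have := Complex.hasSum_taylorSeries_on_ball (differentiableOn_symbol_eulerGen hK hτ)
    (z := ζ) (by simpa using hζ)
  refine hasSum_of_eq this (fun m => ?_) rfl
  rw [sub_zero, cqWeight, smul_comm]

lemma norm_cqWeight_le_of_radius (hK : DifferentiableOn ℂ K {s : ℂ | 0 < s.re})
    (hb : ∀ s : ℂ, 0 < s.re → ‖K s‖ ≤ M₀ * ‖s‖ ^ μ) (hτ : 0 < τ) {A r : ℝ} (h0 : 1 / 2 ≤ r)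
    (h1 : r < 1)
    (hA : (2 * Real.pi)⁻¹ * ∫ θ in (0 : ℝ)..2 * Real.pi, ‖1 - circleMap 0 r θ‖ ^ μ ≤ A) (m : ℕ) :
    ‖cqWeight K τ m‖ ≤ A * (M₀ * τ ^ (-μ)) * r⁻¹ ^ m := by
  have hr : 0 < r := by linarith
  set F := fun ζ : ℂ => K (eulerGen ζ / (τ : ℂ)) with hF
  lift r to NNReal using hr.le
  have hps := (differentiableOn_symbol_eulerGen hK hτ).mono
    (Metric.closedBall_subset_ball h1) |>.hasFPowerSeriesOnBall (by exact_mod_cast hr)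
  have hW : cqWeight K τ m = cauchyPowerSeries F 0 r m (fun _ => 1) := by
    have h2 := hps.factorial_smul 1 m
    rw [cqWeight, iteratedDeriv_eq_iteratedFDeriv, ← h2, ← Nat.cast_smul_eq_nsmul ℂ, smul_smul,
      inv_mul_cancel₀ (by exact_mod_cast m.factorial_ne_zero), one_smul]
  have h3 := norm_cauchyPowerSeries_le F 0 r m
  have hM : 0 ≤ M₀ * τ ^ (-μ) := mul_nonneg (symbolBound_nonneg hb) (by positivity)
  have hnorm : ∀ θ, ‖circleMap 0 (r : ℝ) θ‖ = r := fun θ => by simp [circleMap]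
  have hcont : Continuous fun θ => ‖F (circleMap 0 r θ)‖ := by
    refine Continuous.norm (continuous_iff_continuousAt.2 fun θ => ?_)
    have h4 := ((differentiableOn_symbol_eulerGen hK hτ).differentiableAt
      (Metric.isOpen_ball.mem_nhds (x := circleMap 0 (r : ℝ) θ)
        (by rw [mem_ball_zero_iff, hnorm]; exact h1))).continuousAt
    exact ContinuousAt.comp (f := circleMap 0 (r : ℝ)) h4 (continuous_circleMap 0 _).continuousAt
  have hint : ∫ θ in (0 : ℝ)..2 * Real.pi, ‖F (circleMap 0 r θ)‖ ≤
      M₀ * τ ^ (-μ) * ∫ θ in (0 : ℝ)..2 * Real.pi, ‖1 - circleMap 0 r θ‖ ^ μ := by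
    rw [← intervalIntegral.integral_const_mul]
    refine intervalIntegral.integral_mono_on Real.two_pi_pos.le (hcont.intervalIntegrable _ _)
      (Continuous.intervalIntegrable ?_ _ _) fun θ _ => ?_
    · refine continuous_const.mul (Continuous.rpow_const
        (continuous_const.sub (continuous_circleMap 0 _)).norm ?_)
      exact fun θ => Or.inl (norm_one_sub_circleMap_pos hr.le h1 θ).ne'
    · exact norm_symbol_le hb hτ (re_eulerGen_pos (by rw [hnorm]; exact h1))
  rw [hW]
  have h5 := (cauchyPowerSeries F 0 (r : ℝ) m).le_opNorm (fun _ => 1)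
  simp only [norm_one, Finset.prod_const_one, mul_one] at h5
  refine (h5.trans h3).trans ?_
  rw [abs_of_pos hr]
  refine mul_le_mul_of_nonneg_right ?_ (by positivity)
  calc _ ≤ (2 * Real.pi)⁻¹ * (M₀ * τ ^ (-μ) *
        ∫ θ in (0 : ℝ)..2 * Real.pi, ‖1 - circleMap 0 r θ‖ ^ μ) :=
        mul_le_mul_of_nonneg_left hint (by positivity)
    _ = ((2 * Real.pi)⁻¹ * ∫ θ in (0 : ℝ)..2 * Real.pi, ‖1 - circleMap 0 r θ‖ ^ μ) *
        (M₀ * τ ^ (-μ)) := by ring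
    _ ≤ _ := mul_le_mul_of_nonneg_right hA hM

/-- The Cauchy estimate holds for all `r < 1` with the same `A`, so `r → 1` removes the growth
`r^(-m)`. -/
theorem norm_cqWeight_le (hK : DifferentiableOn ℂ K {s : ℂ | 0 < s.re})
    (hb : ∀ s : ℂ, 0 < s.re → ‖K s‖ ≤ M₀ * ‖s‖ ^ μ) (hτ : 0 < τ) {A : ℝ}
    (hA : ∀ r : ℝ, 1 / 2 ≤ r → r < 1 →
      (2 * Real.pi)⁻¹ * ∫ θ in (0 : ℝ)..2 * Real.pi, ‖1 - circleMap 0 r θ‖ ^ μ ≤ A) (m : ℕ) :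
    ‖cqWeight K τ m‖ ≤ A * (M₀ * τ ^ (-μ)) := by
  have hlim : Filter.Tendsto (fun r : ℝ => A * (M₀ * τ ^ (-μ)) * r⁻¹ ^ m)
      (nhdsWithin 1 (Set.Iio 1)) (nhds (A * (M₀ * τ ^ (-μ)) * (1 : ℝ)⁻¹ ^ m)) := by
    refine Filter.Tendsto.mono_left ?_ nhdsWithin_le_nhds
    exact ((tendsto_inv₀ one_ne_zero).pow m).const_mul _
  rw [inv_one, one_pow, mul_one] at hlim
  refine ge_of_tendsto hlim ?_
  filter_upwards [Ioo_mem_nhdsLT (show (1 / 2 : ℝ) < 1 by norm_num)] with r hr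
  exact norm_cqWeight_le_of_radius hK hb hτ hr.1.le hr.2 (hA r hr.1.le hr.2) m

end Weights

/-! ### Aliasing error of the trapezoidal rule -/

section Aliasing

variable {N L : ℕ} {lam : ℝ}

lemma contourFun_eq_root {E : Type*} (K : ℂ → E) (τ : ℝ) (hL : L ≠ 0) (l : ℕ) :
    contourFun K τ lam (2 * Real.pi * (l : ℝ) / (L : ℝ)) =
      K (eulerGen ((lam : ℂ) * (rootL L)⁻¹ ^ l) / (τ : ℂ)) := by
  have : (L : ℂ) ≠ 0 := by exact_mod_cast hL
  have e : Complex.exp (-(((2 * Real.pi * (l : ℝ) / (L : ℝ) : ℝ) : ℂ) * Complex.I)) =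
      (rootL L)⁻¹ ^ l := by
    rw [rootL, ← Complex.exp_neg, ← Complex.exp_nat_mul]
    congr 1
    push_cast
    field_simp
  rw [contourFun, e]

/-- The part of the `m`-th term of the generating series that is sampled by the trapezoidal rule
with `L` nodes. -/
lemma hasSum_trapezoid {E : Type*} [NormedAddCommGroup E] [NormedSpace ℂ E] (hL : L ≠ 0)
    {W : ℕ → E} {F : ℂ → E} (n j : ℕ)
    (hW : ∀ l : ℕ, HasSum (fun m => ((lam : ℂ) * (rootL L)⁻¹ ^ l) ^ m • W m)
      (F ((lam : ℂ) * (rootL L)⁻¹ ^ l))) :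
    HasSum (fun m : ℕ => if (L : ℤ) ∣ (n : ℤ) - j - m then
        (((lam : ℂ) ^ n)⁻¹ * (lam : ℂ) ^ (m + j)) • W m else 0)
      ((((lam : ℂ) ^ n)⁻¹ / (L : ℂ)) • ∑ l ∈ Finset.range L,
        (rootL L ^ (l * n) * ((lam : ℂ) ^ j * (rootL L ^ (j * l))⁻¹)) •
          F ((lam : ℂ) * (rootL L)⁻¹ ^ l)) := by
  have hLc : (L : ℂ) ≠ 0 := by exact_mod_cast hL
  have hz := rootL_isPrimitiveRoot hL
  have hz0 := hz.ne_zero hL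
  have h1 := (hasSum_sum (s := Finset.range L) fun l _ => (hW l).const_smul
    (rootL L ^ (l * n) * ((lam : ℂ) ^ j * (rootL L ^ (j * l))⁻¹))).const_smul
    (((lam : ℂ) ^ n)⁻¹ / (L : ℂ))
  refine hasSum_of_eq h1 (fun m => ?_) rfl
  have h2 := sum_zpow_pow_primitiveRoot hz ((n : ℤ) - j - m)
  have h3 : ∀ l ∈ Finset.range L,
      (rootL L ^ (l * n) * ((lam : ℂ) ^ j * (rootL L ^ (j * l))⁻¹)) •
        ((lam : ℂ) * (rootL L)⁻¹ ^ l) ^ m • W m =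
      (rootL L ^ ((n : ℤ) - j - m)) ^ l • (lam : ℂ) ^ (m + j) • W m := by
    intro l _
    rw [smul_smul, smul_smul]
    congr 1
    rw [zpow_sub₀ hz0, zpow_sub₀ hz0, zpow_natCast, zpow_natCast, zpow_natCast, div_pow, div_pow,
      ← pow_mul, ← pow_mul, ← pow_mul, mul_pow, ← pow_mul, inv_pow, mul_comm n l, mul_comm m l,
      pow_add]
    field_simp
  rw [Finset.sum_congr rfl h3, ← Finset.sum_smul, h2]
  split_ifs with h
  · rw [smul_smul, smul_smul]
    congr 1
    field_simp
  · simp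

/-- Each entry of the trapezoidal approximation of the convolution matrix differs from the exact
entry by the aliased weights only. -/
lemma norm_trapezoid_sub_le {E : Type*} [NormedAddCommGroup E] [NormedSpace ℂ E] (hL : L ≠ 0)
    (h0 : 0 < lam) (h1 : lam < 1) {W : ℕ → E} {F : ℂ → E} {A : ℝ} (hA : ∀ m, ‖W m‖ ≤ A) {n j : ℕ}
    (hn : n ≤ L) (hj : j ≤ L) (hnj : ¬ (n = L ∧ j = 0))
    (hW : ∀ l : ℕ, HasSum (fun m => ((lam : ℂ) * (rootL L)⁻¹ ^ l) ^ m • W m)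
      (F ((lam : ℂ) * (rootL L)⁻¹ ^ l))) :
    ‖(((lam : ℂ) ^ n)⁻¹ / (L : ℂ)) • (∑ l ∈ Finset.range L,
        (rootL L ^ (l * n) * ((lam : ℂ) ^ j * (rootL L ^ (j * l))⁻¹)) •
          F ((lam : ℂ) * (rootL L)⁻¹ ^ l)) - (if j ≤ n then W (n - j) else 0)‖ ≤
      A * (lam ^ L / (1 - lam ^ L)) := by
  have hs := hasSum_trapezoid hL n j hW
  have hmain : HasSum (fun m : ℕ => if m + j = n then W m else 0)
      (if j ≤ n then W (n - j) else 0) := by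
    have h2 := hasSum_single (f := fun m : ℕ => if m + j = n then W m else 0) (n - j)
      (fun m hm => if_neg (by omega))
    refine hasSum_of_eq h2 (fun _ => rfl) ?_
    by_cases h : j ≤ n
    · rw [if_pos h, if_pos (by omega)]
    · rw [if_neg h, if_neg (by omega)]
  have hD := hs.sub hmain
  have hlamL : lam ^ L < 1 := pow_lt_one₀ h0.le h1 hL
  have hA0 : 0 ≤ A := (norm_nonneg _).trans (hA 0)
  have hlc : (lam : ℂ) ≠ 0 := by exact_mod_cast h0.ne'
  set b : ℕ → ℝ := fun m => if (L : ℤ) ∣ (n : ℤ) - j - m ∧ m + j ≠ n then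
    A * ((lam ^ n)⁻¹ * lam ^ (m + j)) else 0 with hb
  have hbsum : HasSum b (A * (lam ^ L / (1 - lam ^ L))) := by
    -- The aliased indices are `m = (k+1)L + n - j` with `k ≥ 0`, each carrying the damping
    -- `λ^((k+1)L)`. The natural subtraction does not truncate, as `j ≤ L`.
    have hinj : Function.Injective (fun k : ℕ => (k + 1) * L + n - j) := by
      intro k k' hkk
      have e1 : (k + 1) * L = k * L + L := by ring
      have e2 : (k' + 1) * L = k' * L + L := by ring
      simp only [e1, e2] at hkk
      have : k * L = k' * L := by omega
      exact Nat.eq_of_mul_eq_mul_right (Nat.pos_of_ne_zero hL) this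
    rw [← hinj.hasSum_iff]
    · have hg := (hasSum_geometric_of_lt_one (by positivity) hlamL).mul_left (A * lam ^ L)
      refine hasSum_of_eq hg (fun k => ?_) (by ring)
      have e1 : (k + 1) * L = k * L + L := by ring
      have e2 : (k + 1) * L + n - j + j = (k + 1) * L + n := by omega
      have hLpos := Nat.pos_of_ne_zero hL
      have hdvd : (L : ℤ) ∣ (n : ℤ) - j - ((k + 1) * L + n - j : ℕ) := by
        have : (((k + 1) * L + n - j : ℕ) : ℤ) = ((k + 1) * L + n : ℕ) - (j : ℤ) := by omega
        exact ⟨-(k + 1), by rw [this]; push_cast; ring⟩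
      have hne : (k + 1) * L + n - j + j ≠ n := by omega
      simp only [Function.comp, hb]
      rw [if_pos ⟨hdvd, hne⟩, e2, pow_add, e1, pow_add, pow_mul' lam]
      field_simp
    · intro m hm
      refine if_neg fun ⟨⟨q, hq⟩, hne⟩ => hm ?_
      have hLpos : (0 : ℤ) < L := by exact_mod_cast Nat.pos_of_ne_zero hL
      have hq0 : q < 0 := by
        rcases lt_trichotomy q 0 with h | h | h
        · exact h
        · subst h; omega
        -- A positive multiple would force `n = L`, `j = m = 0`, the excluded pair, for which the
        -- alias would be amplified by `λ^(-L)`.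
        · have : (L : ℤ) * 1 ≤ L * q := mul_le_mul_of_nonneg_left (by omega) hLpos.le
          omega
      obtain ⟨k, hk⟩ := Int.eq_ofNat_of_zero_le (show 0 ≤ -q - 1 by omega)
      have hqk : q = -((k : ℤ) + 1) := by omega
      refine ⟨k, ?_⟩
      have e3 : (((k + 1) * L : ℕ) : ℤ) = m + j - n := by
        push_cast; rw [hqk] at hq; linarith
      show (k + 1) * L + n - j = m
      omega
  rw [← hD.tsum_eq]
  refine tsum_of_norm_bounded hbsum fun m => ?_
  by_cases hmn : m + j = n
  · have hdvd : (L : ℤ) ∣ (n : ℤ) - j - m := ⟨0, by omega⟩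
    have hr : ((lam : ℂ) ^ n)⁻¹ * (lam : ℂ) ^ (m + j) = 1 := by
      rw [hmn, inv_mul_cancel₀ (pow_ne_zero _ hlc)]
    simp only [hb, if_pos hdvd, if_pos hmn]
    rw [if_neg (by tauto), hr, one_smul, sub_self, norm_zero]
  · simp only [hb, if_neg hmn, sub_zero]
    by_cases hdvd : (L : ℤ) ∣ (n : ℤ) - j - m
    · rw [if_pos hdvd, if_pos ⟨hdvd, hmn⟩, norm_smul, mul_comm A]
      refine mul_le_mul (le_of_eq ?_) (hA m) (norm_nonneg _) (by positivity)
      rw [norm_mul, norm_inv, norm_pow, norm_pow, Complex.norm_real, Real.norm_of_nonneg h0.le]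
    · rw [if_neg hdvd, if_neg (by tauto), norm_zero]

end Aliasing

/-! ### Quadrature error in the discrete norm -/

section Error

variable {X : Type*} [NormedAddCommGroup X] [InnerProductSpace ℂ X]
  {Y : Type*} [NormedAddCommGroup Y] [InnerProductSpace ℂ Y] [CompleteSpace Y]

lemma norm_cq_sub_trapezoid_le {K : ℂ → X →L[ℂ] Y} {τ lam A : ℝ} {N L : ℕ} (hL : L ≠ 0)
    (hNL : N ≤ L) (h0 : 0 < lam) (h1 : lam < 1)
    (hK : DifferentiableOn ℂ K {s : ℂ | 0 < s.re}) (hτ : 0 < τ) (hA : ∀ m, ‖cqWeight K τ m‖ ≤ A)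
    {g : ℕ → X} (hg : L = N → g 0 = 0) {n : ℕ} (hn : n ≤ N) :
    ‖cq K τ g n - scaledMultiplier N L lam
      (fun l => contourFun K τ lam (2 * Real.pi * (l : ℝ) / (L : ℝ))) g n‖ ≤
      A * (lam ^ L / (1 - lam ^ L)) * ∑ j ∈ Finset.range (N + 1), ‖g j‖ := by
  set F : ℂ → X →L[ℂ] Y := fun ζ => K (eulerGen ζ / (τ : ℂ)) with hF
  have hnormroot : ∀ l : ℕ, ‖(lam : ℂ) * (rootL L)⁻¹ ^ l‖ < 1 := by
    intro l
    rw [norm_mul, norm_pow, norm_inv, (rootL_isPrimitiveRoot hL).norm'_eq_one hL, Complex.norm_real,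
      Real.norm_of_nonneg h0.le]
    simpa using h1
  have hW : ∀ l : ℕ, HasSum (fun m => ((lam : ℂ) * (rootL L)⁻¹ ^ l) ^ m • cqWeight K τ m)
      (F ((lam : ℂ) * (rootL L)⁻¹ ^ l)) := fun l => hasSum_cqWeight hK hτ (hnormroot l)
  set T : ℕ → X →L[ℂ] Y := fun j => (((lam : ℂ) ^ n)⁻¹ / (L : ℂ)) • ∑ l ∈ Finset.range L,
        (rootL L ^ (l * n) * ((lam : ℂ) ^ j * (rootL L ^ (j * l))⁻¹)) •
          F ((lam : ℂ) * (rootL L)⁻¹ ^ l) with hT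
  have e1 : scaledMultiplier N L lam
      (fun l => contourFun K τ lam (2 * Real.pi * (l : ℝ) / (L : ℝ))) g n =
      ∑ j ∈ Finset.range (N + 1), T j (g j) := by
    simp only [scaledMultiplier, scaledDFT, contourFun_eq_root K τ hL, hT, map_sum, map_smul,
      _root_.smul_apply, _root_.sum_apply, ← Finset.smul_sum]
    congr 1
    simp only [Finset.smul_sum, smul_smul]
    rw [Finset.sum_comm]
  have e2 : cq K τ g n = ∑ j ∈ Finset.range (N + 1),
      (if j ≤ n then cqWeight K τ (n - j) else 0) (g j) := by
    rw [cq]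
    refine Finset.sum_subset_zero_on_sdiff (Finset.range_mono (by omega)) ?_ ?_
    · intro j hj; simp at hj; rw [if_neg (by omega)]; simp
    · intro j hj; simp at hj; rw [if_pos (by omega)]
  rw [e1, e2, ← Finset.sum_sub_distrib, Finset.mul_sum]
  refine norm_sum_le_of_le _ fun j hj => ?_
  have hj' : j ≤ N := by simp at hj; omega
  by_cases hnj : n = L ∧ j = 0
  · have hg0 : g j = 0 := by rw [hnj.2]; exact hg (by omega)
    simp [hg0]
  · rw [norm_sub_rev, ← _root_.sub_apply]
    refine (ContinuousLinearMap.le_opNorm _ _).trans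
      (mul_le_mul_of_nonneg_right ?_ (norm_nonneg _))
    exact norm_trapezoid_sub_le hL h0 h1 hA (by omega) (by omega) hnj hW

lemma ellNorm_add_le {Z : Type*} [NormedAddCommGroup Z] (N : ℕ) (x y : ℕ → Z) :
    ellNorm N (fun n => x n + y n) ≤ ellNorm N x + ellNorm N y := by
  simp only [ellNorm]
  rw [Real.sqrt_mul (by positivity), Real.sqrt_mul (by positivity), Real.sqrt_mul (by positivity),
    ← mul_add]
  refine mul_le_mul_of_nonneg_left ?_ (Real.sqrt_nonneg _)
  have h := Real.Lp_add_le (Finset.range (N + 1)) (fun n => ‖x n‖) (fun n => ‖y n‖)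
    (p := 2) one_le_two
  simp only [← Real.sqrt_eq_rpow, Real.rpow_two, sq_abs] at h
  refine (Real.sqrt_le_sqrt (Finset.sum_le_sum fun n _ => ?_)).trans h
  exact pow_le_pow_left₀ (norm_nonneg _) (norm_add_le _ _) 2

lemma ellNorm_le_of_sum_le {Z Z' : Type*} [NormedAddCommGroup Z] [NormedAddCommGroup Z'] {N : ℕ}
    {x : ℕ → Z} {y : ℕ → Z'} {c : ℝ} (hc : 0 ≤ c)
    (h : ∑ n ∈ Finset.range (N + 1), ‖x n‖ ^ 2 ≤ c ^ 2 * ∑ n ∈ Finset.range (N + 1), ‖y n‖ ^ 2) :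
    ellNorm N x ≤ c * ellNorm N y := by
  rw [ellNorm, ellNorm, ← Real.sqrt_sq hc, ← Real.sqrt_mul (sq_nonneg c)]
  refine Real.sqrt_le_sqrt ?_
  calc _ ≤ (N : ℝ)⁻¹ * (c ^ 2 * ∑ n ∈ Finset.range (N + 1), ‖y n‖ ^ 2) :=
        mul_le_mul_of_nonneg_left h (by positivity)
    _ = _ := by ring

lemma ellNorm_le_of_norm_le_sum {Z Z' : Type*} [NormedAddCommGroup Z] [NormedAddCommGroup Z']
    {N : ℕ} {x : ℕ → Z} {y : ℕ → Z'} {c : ℝ} (hc : 0 ≤ c)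
    (h : ∀ n ≤ N, ‖x n‖ ≤ c * ∑ j ∈ Finset.range (N + 1), ‖y j‖) :
    ellNorm N x ≤ ((N + 1 : ℕ) : ℝ) * c * ellNorm N y := by
  refine ellNorm_le_of_sum_le (by positivity) ?_
  have h1 := sq_sum_le_card_mul_sum_sq (s := Finset.range (N + 1)) (f := fun j => ‖y j‖)
  rw [Finset.card_range] at h1
  calc _ ≤ ∑ n ∈ Finset.range (N + 1),
        c ^ 2 * (((N + 1 : ℕ) : ℝ) * ∑ j ∈ Finset.range (N + 1), ‖y j‖ ^ 2) := by
        refine Finset.sum_le_sum fun n hn => ?_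
        refine (pow_le_pow_left₀ (norm_nonneg _)
          (h n (Nat.lt_succ_iff.1 (Finset.mem_range.1 hn))) 2).trans ?_
        rw [mul_pow]
        exact mul_le_mul_of_nonneg_left h1 (sq_nonneg c)
    _ = _ := by rw [Finset.sum_const, Finset.card_range, nsmul_eq_mul]; ring

end Error

/-- Bound for `|1 - λ e^{-iz}|^μ` on the Bernstein ellipses of the mesh. -/
def symbolConst (μ lam : ℝ) : ℝ :=
  if 0 ≤ μ then 4 ^ μ else |Real.sin (leftBound lam)| ^ μ

lemma symbolConst_nonneg (μ lam : ℝ) : 0 ≤ symbolConst μ lam := by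
  unfold symbolConst
  split_ifs <;> positivity

lemma rpow_le_symbolConst {μ lam x : ℝ} (h0 : 0 < lam) (h1 : lam < 1) (hx : x ≤ 4)
    (hx' : Real.sin (leftBound lam) ≤ x) : x ^ μ ≤ symbolConst μ lam := by
  have hb : leftBound lam ≤ 73 / 100 := min_le_right _ _
  have hs : 0 < Real.sin (leftBound lam) :=
    Real.sin_pos_of_pos_of_lt_pi (leftBound_pos h0 h1) (by linarith [Real.pi_gt_three])
  unfold symbolConst
  split_ifs with h
  · exact Real.rpow_le_rpow (by linarith) hx h
  · rw [abs_of_pos hs]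
    exact Real.rpow_le_rpow_of_nonpos hs hx' (by linarith)

/-- Interpolation error of the contour function on the mesh. -/
theorem norm_contourFun_sub_meshInterp_le {E : Type*} [NormedAddCommGroup E] [NormedSpace ℂ E]
    {K : ℂ → E} {M₀ μ τ ε lam : ℝ} {N : ℕ} (h0 : 0 < lam) (h1 : lam < 1)
    (hK : DifferentiableOn ℂ K {s : ℂ | 0 < s.re})
    (hb : ∀ s : ℂ, 0 < s.re → ‖K s‖ ≤ M₀ * ‖s‖ ^ μ) (hτ : 0 < τ)
    (hΦ : meshPoint N ε lam 0 = firstPoint lam) (hπ : meshPoint N ε lam 0 < Real.pi)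
    {e : ℝ → ℕ} (he : IsElementChoice N ε lam e) (p : ℕ) {φ : ℝ}
    (hφ : φ ∈ Set.Icc 0 (2 * Real.pi)) :
    ‖contourFun K τ lam φ - meshInterp N ε lam e p (contourFun K τ lam) φ‖ ≤
      4 * (M₀ * τ ^ (-μ) * symbolConst μ lam) * (1 / 2) ^ p := by
  have hM := symbolBound_nonneg hb
  have hc := symbolConst_nonneg μ lam
  unfold meshInterp
  split_ifs with hcase
  · rw [sub_self, norm_zero]; positivity
  · obtain ⟨hle, hmem⟩ := he φ hφ
    push Not at hcase
    obtain ⟨hlt, hell⟩ := contourArg_mem_of_ellipse h0 h1 hΦ hπ hcase.1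
      (lt_of_le_of_ne hle hcase.2)
    refine chebInterp_error (F := fun z => K (contourArg lam z / τ)) hlt ?_ ?_ p hmem
    · intro w hw1 hw2
      refine (differentiableAt_symbol hK hτ (hell w hw1 hw2).1).comp _ ?_
      unfold contourArg
      fun_prop
    · intro w hw1 hw2
      obtain ⟨h2, h3, h4⟩ := hell w hw1 hw2
      exact (norm_symbol_le hb hτ h2).trans
        (mul_le_mul_of_nonneg_left (rpow_le_symbolConst h0 h1 h3 h4) (by positivity))

end ParsimoniousCQ

end

/-! ### Assembly of the error bound -/

theorem mainTheorem2 (μ : ℝ) (hμ : -1 < μ) :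
    ∃ C : ℝ → ℝ, (∀ lam, 0 < C lam) ∧ (0 ≤ μ → ∀ lam lam', C lam = C lam') ∧
      ∀ (X : Type*) [NormedAddCommGroup X] [InnerProductSpace ℂ X] [CompleteSpace X]
        (Y : Type*) [NormedAddCommGroup Y] [InnerProductSpace ℂ Y] [CompleteSpace Y]
        (K : ℂ → X →L[ℂ] Y) (M₀ : ℝ),
        DifferentiableOn ℂ K {s : ℂ | 0 < s.re} →
        (∀ s : ℂ, 0 < s.re → ‖K s‖ ≤ M₀ * ‖s‖ ^ μ) →
        ∀ (N L p : ℕ) (τ ε lam : ℝ), 1 ≤ N → N ≤ L → 0 < τ →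
          0 < ε → ε < 1 → lam = ε ^ (1 / (2 * (N : ℝ))) →
          ParsimoniousCQ.meshPoint N ε lam 0 < Real.pi →
          ∀ e : ℝ → ℕ, ParsimoniousCQ.IsElementChoice N ε lam e →
          ∀ g : ℕ → X, (L = N → g 0 = 0) →
            ParsimoniousCQ.ellNorm N (fun n => ParsimoniousCQ.cq K τ g n -
                ParsimoniousCQ.parsimoniousCQ K τ N L p ε lam e g n)
              ≤ C lam * M₀ * τ ^ (-μ) *
                ((N : ℝ) * (lam ^ L / (1 - lam ^ L)) + (lam ^ N)⁻¹ * ((2 : ℝ) ^ p)⁻¹) *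
                ParsimoniousCQ.ellNorm N g := by
  obtain ⟨A, hA0, hA⟩ := ParsimoniousCQ.exists_integral_rpow_le hμ
  -- `2A` comes from `N + 1 ≤ 2N` in the aliasing part; `8` is the `4` of Chebyshev interpolation
  -- times the `2` of the Fourier estimate.
  refine ⟨fun lam => 2 * A + 8 * ParsimoniousCQ.symbolConst μ lam, fun lam => ?_,
    fun h lam lam' => ?_, ?_⟩
  · have := ParsimoniousCQ.symbolConst_nonneg μ lam
    positivity
  · simp only [ParsimoniousCQ.symbolConst, if_pos h]
  intro X _ _ _ Y _ _ _ K M₀ hK hb N L p τ ε lam hN hNL hτ hε0 hε1 hlam hπ e he g hg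
  obtain ⟨h0, h1⟩ := ParsimoniousCQ.lam_pos_lt_one hN hε0 hε1 hlam
  have hL : L ≠ 0 := by omega
  have hΦ := ParsimoniousCQ.meshPoint_zero_eq hN hε0 hε1 hlam
  have hM := ParsimoniousCQ.symbolBound_nonneg hb
  have hS := ParsimoniousCQ.symbolConst_nonneg μ lam
  have hlamL : 0 < 1 - lam ^ L := by linarith [pow_lt_one₀ h0.le h1 hL]
  set f := ParsimoniousCQ.contourFun K τ lam with hf
  set φ : ℕ → ℝ := fun l => 2 * Real.pi * (l : ℝ) / (L : ℝ) with hφdef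
  have hφ : ∀ l < L, φ l ∈ Set.Icc 0 (2 * Real.pi) := by
    intro l hl
    have hl' : (l : ℝ) ≤ L := by exact_mod_cast hl.le
    have hL' : (0 : ℝ) < L := by exact_mod_cast Nat.pos_of_ne_zero hL
    refine ⟨by positivity, ?_⟩
    rw [hφdef, div_le_iff₀ hL']
    exact mul_le_mul_of_nonneg_left hl' Real.two_pi_pos.le
  set E : ℕ → X →L[ℂ] Y := fun l =>
    f (φ l) - ParsimoniousCQ.meshInterp N ε lam e p f (φ l) with hE
  have hsplit : (fun n => ParsimoniousCQ.cq K τ g n -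
      ParsimoniousCQ.parsimoniousCQ K τ N L p ε lam e g n) = fun n =>
      (ParsimoniousCQ.cq K τ g n - ParsimoniousCQ.scaledMultiplier N L lam (fun l => f (φ l)) g n) +
        ParsimoniousCQ.scaledMultiplier N L lam E g n := by
    funext n
    have : ParsimoniousCQ.scaledMultiplier N L lam E g n =
        ParsimoniousCQ.scaledMultiplier N L lam (fun l => f (φ l)) g n -
          ParsimoniousCQ.parsimoniousCQ K τ N L p ε lam e g n := by
      simp only [ParsimoniousCQ.scaledMultiplier, ParsimoniousCQ.parsimoniousCQ, hE,
        _root_.sub_apply, smul_sub, Finset.sum_sub_distrib]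
      rfl
    rw [this]; abel
  rw [hsplit]
  have hW := ParsimoniousCQ.norm_cqWeight_le hK hb hτ hA
  have hq : 0 ≤ lam ^ L / (1 - lam ^ L) := by positivity
  have hpart1 := ParsimoniousCQ.ellNorm_le_of_norm_le_sum
    (c := A * (M₀ * τ ^ (-μ)) * (lam ^ L / (1 - lam ^ L))) (by positivity) fun n hn =>
    ParsimoniousCQ.norm_cq_sub_trapezoid_le (lam := lam) hL hNL h0 h1 hK hτ hW hg hn
  have hpart2 : ParsimoniousCQ.ellNorm N (ParsimoniousCQ.scaledMultiplier N L lam E g) ≤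
      2 * (4 * (M₀ * τ ^ (-μ) * ParsimoniousCQ.symbolConst μ lam) * (1 / 2) ^ p) *
        (lam ^ N)⁻¹ * ParsimoniousCQ.ellNorm N g :=
    ParsimoniousCQ.ellNorm_le_of_sum_le (by positivity)
      (ParsimoniousCQ.sum_norm_sq_scaledMultiplier_le hL hNL h0 h1 (fun l hl =>
        ParsimoniousCQ.norm_contourFun_sub_meshInterp_le h0 h1 hK hb hτ hΦ hπ he p (hφ l hl)) g)
  refine (ParsimoniousCQ.ellNorm_add_le N _ _).trans ((add_le_add hpart1 hpart2).trans ?_)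
  rw [← add_mul]
  refine mul_le_mul_of_nonneg_right ?_ (Real.sqrt_nonneg _)
  have hN' : ((N + 1 : ℕ) : ℝ) ≤ 2 * N := by
    have : (1 : ℝ) ≤ N := by exact_mod_cast hN
    push_cast; linarith
  have hhalf : (1 / 2 : ℝ) ^ p = ((2 : ℝ) ^ p)⁻¹ := by rw [one_div, inv_pow]
  rw [hhalf]
  have hB : 0 ≤ M₀ * τ ^ (-μ) := by positivity
  have hq1 : ((N + 1 : ℕ) : ℝ) * (A * (M₀ * τ ^ (-μ)) * (lam ^ L / (1 - lam ^ L))) ≤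
      2 * N * (A * (M₀ * τ ^ (-μ)) * (lam ^ L / (1 - lam ^ L))) :=
    mul_le_mul_of_nonneg_right hN' (by positivity)
  have hq2 : 0 ≤ 8 * ParsimoniousCQ.symbolConst μ lam * (M₀ * τ ^ (-μ)) *
      (N * (lam ^ L / (1 - lam ^ L))) := by positivity
  have hq3 : 0 ≤ 2 * A * (M₀ * τ ^ (-μ)) * ((lam ^ N)⁻¹ * ((2 : ℝ) ^ p)⁻¹) := by positivity
  linarith
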